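/- **Setting.** Let $\iota$ be a set of modes (finite or infinite), labelling an orthonormal basis $\{\varphi_i\}$ of the one-particle space, with bosonic operators $a_i,a_i^\dagger$, $[a_i,a_j^\dagger]=\delta_{ij}$, $[a_i,a_j]=0$, on Fock space. For $i=(i_1,\dots,i_N)\in\iota^N$ put $|\varphi_{i_1}\cdots\varphi_{i_N}\rangle=\frac1{\sqrt{N!}}a^\dagger_{i_1}\cdots a^\dagger_{i_N}|0\rangle$, so that $\sum_{i\in\iota^N}|\varphi_{i_1}\cdots\varphi_{i_N}\rangle\langle\varphi_{i_1}\cdots\varphi_{i_N}|$ is the identity of the $N$-particle space. An $N$-particle operator $A$ is given by its matrix elements $A_{i;j}=\langle\varphi_{i_1}\cdots\varphi_{i_N}|A|\varphi_{j_1}\cdots\varphi_{j_N}\rangle$; thus $(AB)_{i;j}=\sum_k A_{i;k}B_{k;j}$ and $\mathrm{Tr}^{(N)}\{A\}=\sum_iA_{i;i}$. For tuples $i$ and $n$ of modes we write $in$ for the concatenated tuple. An $S$-particle operator $A$ acts on every $N$-particle space as $\frac1{S!}\sum_{k,l\in\iota^S}A_{k;l}\,a^\dagger_{k_1}\cdots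 a^\dagger_{k_S}a_{l_1}\cdots a_{l_S}$. The bosonic partial trace maps an $N$-particle operator $X$ to the $M$-particle operator $$\mathrm{Tr}^{(N)}_{N-M}\{X\}=\frac{(N-M)!}{N!\,M!}\sum_{n,m\in\iota^M}\mathrm{Tr}^{(N)}\{a^\dagger_{n_1}\cdots a^\dagger_{n_M}a_{m_1}\cdots a_{m_M}X\}\;a^\dagger_{m_1}\cdots a^\dagger_{m_M}a_{n_1}\cdots a_{n_M},$$ taken on the $M$-particle space (it is $0$ if $M>N$). All commutators of operators with different particle numbers below are taken on the particle space of the second operator. **Hypotheses.** Let $0\le M\le N$, $\hbar>0$. Let $H^{(1)}$ and $H^{(2)}$ be a one-particle and a two-particle operator with Hermitian matrix elements (not necessarily bounded), $H=H^{(1)}+H^{(2)}$ with $H^{(1)}=\sum_{ij}H^{(1)}_{ij}a_i^\dagger a_j$, $H^{(2)}=\frac12\sum_{ijkl}H^{(2)}_{ij;kl}a^\dagger_ia^\dagger_ja_ka_l$. Let $\rho^{(N)}(s)$, $s\in\mathbb R$, be $N$-boson density operators (permutation-symmetric matrix elements, positive semidefinite, trace $1$) and write $\rho^{(L)}=\mathrm{Tr}^{(N)}_{N-L}\{\rho^{(N)}\}$.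 Fix a time $t$ at which the von Neumann equation $\partial_t\rho^{(N)}=-\frac i\hbar[H,\rho^{(N)}]$ holds, with convergent sums in the commutator and with the time derivative taken in the trace norm. If $\iota$ is infinite, assume moreover that the mode sums in $\mathrm{Tr}^{(N)}_{N-M}\{H^{(S)}\rho^{(N)}(t)\}$, $S=1,2$, converge absolutely, that is, for all $i,j\in\iota^M$ and all positions $1\le\alpha_1<\dots<\alpha_S\le N$, $$\sum_{n\in\iota^{N-M}}\ \sum_{k\in\iota^S}\bigl|H^{(S)}_{x_{\alpha_1}\cdots x_{\alpha_S};k_1\cdots k_S}\ \rho^{(N)}_{x';\,jn}(t)\bigr|<\infty ,\qquad x=in,$$ where $x'$ is $x$ with the label at position $\alpha_s$ replaced by $k_s$ for each $s$. (For finite $\iota$ this holds trivially.) **Conclusions.** At time $t$, all sums below being convergent: 1. $\mathrm{Tr}^{(N)}_{N-M}\{[H^{(1)},\rho^{(N)}]\}=[H^{(1)},\rho^{(M)}]$. 2. For all $i,j\in\iota^M$, $$\begin{aligned}\mathrm{Tr}^{(N)}_{N-M}\{[H^{(2)},\rho^{(N)}]\}_{i;j}={}&[H^{(2)},\rho^{(M)}]_{i;j}\\&+(N-M)\sum_{a=1}^M\Bigl(\sum_{l,k_1,k_2}H^{(2)}_{i_al;k_1k_2}\,\rho^{(M+1)}_{i[a\to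 k_1]k_2;\,jl}-\sum_{l,k_1,k_2}\rho^{(M+1)}_{il;\,j[a\to k_1]k_2}\,H^{(2)}_{k_1k_2;j_al}\Bigr)\\&+\binom{N-M}2\Bigl(\sum_{l_1,l_2,k_1,k_2}H^{(2)}_{l_1l_2;k_1k_2}\,\rho^{(M+2)}_{ik_1k_2;\,jl_1l_2}-\sum_{l_1,l_2,k_1,k_2}\rho^{(M+2)}_{il_1l_2;\,jk_1k_2}\,H^{(2)}_{k_1k_2;l_1l_2}\Bigr),\end{aligned}$$ where $i[a\to k_1]$ is $i$ with $i_a$ replaced by $k_1$; and the contributions of $\rho^{(M+2)}$ cancel: the last bracket is $0$. 3. $\rho^{(M)}$ is differentiable at $t$ in the trace norm and $$i\hbar\frac{\partial}{\partial t}\rho^{(M)}=\bigl[H^{(1)}+(1-(N-M))H^{(2)},\rho^{(M)}\bigr]+(N-M)\,\mathrm{Tr}^{(M+1)}_1\bigl\{[H^{(2)},\rho^{(M+1)}]\bigr\}.$$ -/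

import Mathlib

open scoped ComplexOrder ENNReal Topology

namespace BosonHierarchy

/-! ## Bosonic Fock space over a set `ι` of modes

`ι` indexes an orthonormal basis of the one-particle space. An `N`-particle amplitude is a function
of `N` mode labels, a Fock amplitude is a sequence of those. -/

/-- Amplitudes of all particle numbers: `Ψ N i` is the amplitude of `Ψ` at the labels
`i 0, …, i (N - 1)`. -/
abbrev Fock (ι : Type*) : Type _ := (N : ℕ) → (Fin N → ι) → ℂ

/-- The vacuum `|0⟩`. -/
def vacuum (ι : Type*) : Fock ι
  | 0, _ => 1
  | _ + 1, _ => 0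

/-- The annihilation operator `a_k`. -/
noncomputable def annih {ι : Type*} (k : ι) : Module.End ℂ (Fock ι) where
  toFun Ψ := fun N i => (Real.sqrt (N + 1) : ℂ) * Ψ (N + 1) (Fin.cons k i)
  map_add' Φ Ψ := by
    funext N i
    simp [mul_add]
  map_smul' c Ψ := by
    funext N i
    simp [mul_left_comm]

/-- The value of `a†_k Ψ`. -/
noncomputable def createFun {ι : Type*} [DecidableEq ι] (k : ι) (Ψ : Fock ι) : Fock ι
  | 0, _ => 0
  | N + 1, i => ((Real.sqrt (N + 1) : ℂ))⁻¹ *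
      ∑ p : Fin (N + 1), if i p = k then Ψ N (fun q => i (p.succAbove q)) else 0

/-- The creation operator `a†_k`. -/
noncomputable def create {ι : Type*} [DecidableEq ι] (k : ι) : Module.End ℂ (Fock ι) where
  toFun := createFun k
  map_add' Φ Ψ := by
    funext N i
    cases N with
    | zero => simp [createFun]
    | succ N =>
      simp only [createFun, Pi.add_apply, ← mul_add, ← Finset.sum_add_distrib]
      congr 1
      refine Finset.sum_congr rfl fun p _ => ?_
      split_ifs <;> simp
  map_smul' c Ψ := by
    funext N i
    cases N with
    | zero => simp [createFun]
    | succ N =>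
      simp only [createFun, Pi.smul_apply, smul_eq_mul, RingHom.id_apply, Finset.mul_sum]
      refine Finset.sum_congr rfl fun p _ => ?_
      split_ifs <;> simp [mul_left_comm]

/-- `a†_{n_1} ⋯ a†_{n_S}`. -/
noncomputable def createString {ι : Type*} [DecidableEq ι] {S : ℕ} (n : Fin S → ι) :
    Module.End ℂ (Fock ι) :=
  (List.ofFn fun p => create (n p)).prod

/-- `a_{m_1} ⋯ a_{m_S}`. -/
noncomputable def annihString {ι : Type*} {S : ℕ} (m : Fin S → ι) : Module.End ℂ (Fock ι) :=
  (List.ofFn fun p => annih (m p)).prod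

/-- `a†_{n_1} ⋯ a†_{n_S} a_{m_1} ⋯ a_{m_S}`. -/
noncomputable def normalString {ι : Type*} [DecidableEq ι] {S : ℕ} (n m : Fin S → ι) :
    Module.End ℂ (Fock ι) :=
  createString n * annihString m

/-- The symmetrized state `|φ_{i_1} ⋯ φ_{i_N}⟩ = (N!)^{-1/2} a†_{i_1} ⋯ a†_{i_N} |0⟩`. -/
noncomputable def ket {ι : Type*} [DecidableEq ι] {N : ℕ} (i : Fin N → ι) : Fock ι :=
  ((Real.sqrt (N.factorial) : ℂ))⁻¹ • createString i (vacuum ι)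

/-- The scalar product of Fock space; it is only used with a symmetrized state on the left,
whose amplitude has finite support. -/
noncomputable def braket {ι : Type*} (Φ Ψ : Fock ι) : ℂ :=
  ∑' x : (Σ N : ℕ, Fin N → ι), star (Φ x.1 x.2) * Ψ x.1 x.2

/-! ## `N`-particle operators

An `N`-particle operator `A` is given by its matrix elements
`A i j = ⟨φ_{i_1} ⋯ φ_{i_N}| A |φ_{j_1} ⋯ φ_{j_N}⟩`. As `∑_i |φ_i⟩⟨φ_i|` (sum over all
label tuples) is the identity of the `N`-particle space, operators multiply as matrices and the
trace is the sum of the diagonal entries. -/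

/-- Matrix elements of an `N`-particle operator. -/
abbrev NOp (ι : Type*) (N : ℕ) : Type _ := Matrix (Fin N → ι) (Fin N → ι) ℂ

/-- Matrix elements between symmetrized states do not depend on the order of the labels. -/
def IsBosonic {ι : Type*} {N : ℕ} (A : NOp ι N) : Prop :=
  ∀ (σ τ : Equiv.Perm (Fin N)) (i j : Fin N → ι), A (i ∘ σ) (j ∘ τ) = A i j

/-- The matrix elements of an operator of Fock space in the `N`-particle space. -/
noncomputable def matrixElements {ι : Type*} [DecidableEq ι] (N : ℕ)
    (T : Module.End ℂ (Fock ι)) : NOp ι N :=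
  fun i j => braket (ket i) (T (ket j))

/-- The `S`-particle operator
`A = (1/S!) ∑_{k,l} A_{k;l} a†_{k_1} ⋯ a†_{k_S} a_{l_1} ⋯ a_{l_S}` on the `N`-particle space.
For given `i`, `j` only finitely many summands are nonzero. -/
noncomputable def onSector {ι : Type*} [DecidableEq ι] {S : ℕ} (A : NOp ι S) (N : ℕ) : NOp ι N :=
  fun i j => ((S.factorial : ℂ))⁻¹ *
    ∑' p : (Fin S → ι) × (Fin S → ι), A p.1 p.2 * matrixElements N (normalString p.1 p.2) i j

/-- The product of two operators, `(A B)_{ij} = ∑_k A_{ik} B_{kj}`. -/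
noncomputable def opMul {ι : Type*} {N : ℕ} (A B : NOp ι N) : NOp ι N :=
  fun i j => ∑' k, A i k * B k j

/-- The mode sums in the entry `(i, j)` of `A B` and of `B A` converge (absolutely). -/
def CommConverges {ι : Type*} {N : ℕ} (A B : NOp ι N) (i j : Fin N → ι) : Prop :=
  Summable (fun k => A i k * B k j) ∧ Summable (fun k => B i k * A k j)

/-- The commutator `[A, B] = A B - B A`. -/
noncomputable def opComm {ι : Type*} {N : ℕ} (A B : NOp ι N) : NOp ι N :=
  fun i j => opMul A B i j - opMul B A i j

/-- The `N`-particle trace `Tr^{(N)}`. -/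
noncomputable def opTrace {ι : Type*} {N : ℕ} (A : NOp ι N) : ℂ := ∑' i, A i i

/-- The partial trace `Tr^{(N)}_{N-M}` from `N` to `M` bosons, that is
`(N-M)!/(N! M!) ∑_{n,m} Tr^{(N)}{a†_{n_1} ⋯ a†_{n_M} a_{m_1} ⋯ a_{m_M} X}
  a†_{m_1} ⋯ a†_{m_M} a_{n_1} ⋯ a_{n_M}`
as an operator of the `M`-particle space. For `M > N` it is zero, since `M` annihilation operators
annihilate every `N`-particle state. -/
noncomputable def partialTrace {ι : Type*} [DecidableEq ι] {N : ℕ} (M : ℕ) (X : NOp ι N) :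
    NOp ι M :=
  fun i j => (((N - M).factorial : ℂ) / ((N.factorial : ℂ) * (M.factorial : ℂ))) *
    ∑' p : (Fin M → ι) × (Fin M → ι),
      opTrace (opMul (matrixElements N (normalString p.1 p.2)) X) *
        matrixElements M (normalString p.2 p.1) i j

/-- All traces in the definition of `partialTrace M X` converge (absolutely). -/
def PartialTraceConverges {ι : Type*} [DecidableEq ι] {N : ℕ} (M : ℕ) (X : NOp ι N) : Prop :=
  ∀ n m : Fin M → ι,
    Summable fun x => opMul (matrixElements N (normalString n m)) X x x

/-- An `N`-boson density operator: symmetric, positive, of trace one. -/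
structure IsDensityOperator {ι : Type*} {N : ℕ} (ρ : NOp ι N) : Prop where
  bosonic : IsBosonic ρ
  posSemidef : Matrix.PosSemidef ρ
  trace_one : HasSum (fun i => ρ i i) 1

/-! ## Time derivatives in trace norm -/

/-- The trace norm: the supremum of the trace norms of the finite diagonal blocks, where the trace
norm of a finite matrix `B` is the maximum of `|Tr (U B)|` over the unitary matrices `U`. -/
noncomputable def traceNorm {α : Type*} [DecidableEq α] (A : Matrix α α ℂ) : ℝ≥0∞ :=
  ⨆ (s : Finset α) (U : Matrix.unitaryGroup s ℂ),
    ‖Matrix.trace ((U : Matrix s s ℂ) * A.submatrix (fun x : s => (x : α)) (fun x : s => (x : α)))‖ₑ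

/-- `D` is the derivative of `ρ` at time `t` with respect to the trace norm. -/
def HasTraceDerivAt {α : Type*} [DecidableEq α] (ρ : ℝ → Matrix α α ℂ) (D : Matrix α α ℂ)
    (t : ℝ) : Prop :=
  Filter.Tendsto (fun s : ℝ => traceNorm (((((s - t)⁻¹ : ℝ) : ℂ)) • (ρ s - ρ t) - D))
    (𝓝[≠] t) (𝓝 0)

/-- The von Neumann equation `∂ρ/∂t = -(i/ħ) [H, ρ]` at time `t`. -/
def VonNeumannAt {ι : Type*} [DecidableEq ι] {N : ℕ} (ħ : ℝ) (H : NOp ι N) (ρ : ℝ → NOp ι N)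
    (t : ℝ) : Prop :=
  (∀ i j, CommConverges H (ρ t) i j) ∧
    HasTraceDerivAt ρ (-(Complex.I / (ħ : ℂ)) • opComm H (ρ t)) t

/-! ## Absolute convergence of mode sums -/

/-- Absolute convergence of the mode sums in `Tr^{(N)}_{N-M} {J ρ}` with `N = M + K`, for an
`S`-particle operator `J`: the sums, over the labels `n` of the `K` traced particles and the inner
labels `k`, of `J_{x_{α_1} ⋯ x_{α_S}; k_1 ⋯ k_S} ρ_{x'; j n}`, where `x = i n` and `x'` is `x`
with the labels at the positions `α_1 < ⋯ < α_S` replaced by `k_1, …, k_S`. -/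
def ModeSumsConverge {ι : Type*} {S : ℕ} (M K : ℕ) (J : NOp ι S) (ρ : NOp ι (M + K)) : Prop :=
  ∀ (α : Fin S ↪o Fin (M + K)) (i j : Fin M → ι),
    Summable fun p : (Fin K → ι) × (Fin S → ι) =>
      J (Fin.append i p.1 ∘ α) p.2 *
        ρ (Function.extend α p.2 (Fin.append i p.1)) (Fin.append j p.1)

/-! ## Terms of the two-particle contribution -/

/-- The summand of the `ρ^{(M+1)}`-contribution to `H^{(2)} ρ` in which one of the two particles,
at position `a`, is kept and the other one is traced out:
`H_{i_a l; k_1 k_2} ρ^{(M+1)}_{i' k_2; j l}`, where `i'` is `i` with `i_a` replaced by `k_1`. -/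
def crossLeft {ι : Type*} {M : ℕ} (H : NOp ι 2) (R : NOp ι (M + 1)) (a : Fin M)
    (i j : Fin M → ι) (p : ι × (Fin 2 → ι)) : ℂ :=
  H ![i a, p.1] p.2 *
    R (Fin.snoc (α := fun _ => ι) (Function.update i a (p.2 0)) (p.2 1))
      (Fin.snoc (α := fun _ => ι) j p.1)

/-- The corresponding summand for `ρ H^{(2)}`:
`ρ^{(M+1)}_{i l; j' k_2} H_{k_1 k_2; j_a l}`, where `j'` is `j` with `j_a` replaced by `k_1`. -/
def crossRight {ι : Type*} {M : ℕ} (H : NOp ι 2) (R : NOp ι (M + 1)) (a : Fin M)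
    (i j : Fin M → ι) (p : ι × (Fin 2 → ι)) : ℂ :=
  R (Fin.snoc (α := fun _ => ι) i p.1)
      (Fin.snoc (α := fun _ => ι) (Function.update j a (p.2 0)) (p.2 1)) *
    H p.2 ![j a, p.1]

/-- The summand `H_{l_1 l_2; k_1 k_2} ρ^{(M+2)}_{i k_1 k_2; j l_1 l_2}` of the contribution to
`H^{(2)} ρ` in which both particles are traced out. -/
def outerLeft {ι : Type*} {M : ℕ} (H : NOp ι 2) (R : NOp ι (M + 2)) (i j : Fin M → ι)
    (p : (Fin 2 → ι) × (Fin 2 → ι)) : ℂ :=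
  H p.1 p.2 * R (Fin.append i p.2) (Fin.append j p.1)

/-- The corresponding summand `ρ^{(M+2)}_{i l_1 l_2; j k_1 k_2} H_{k_1 k_2; l_1 l_2}` for
`ρ H^{(2)}`. -/
def outerRight {ι : Type*} {M : ℕ} (H : NOp ι 2) (R : NOp ι (M + 2)) (i j : Fin M → ι)
    (p : (Fin 2 → ι) × (Fin 2 → ι)) : ℂ :=
  R (Fin.append i p.1) (Fin.append j p.2) * H p.2 p.1

end BosonHierarchy

open BosonHierarchy

namespace BosonHierarchy

/-! ## Occupation numbers -/

/-! Bosonic matrix elements depend only on the multisets of their labels, so identities between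
tuples reduce to counting labels (`occ`, `IsBosonic.eq_of_occ`). A normally ordered string acts as a
sum over embeddings `β : Fin S ↪ Fin N` of its labels into the particle positions
(`normalString_apply`). Hence the product of an `S`-particle operator with `ρ` is `1/S!` times a sum
over `β` of terms in which the operator acts at the positions `β` (`hasSum_onSector_mul`), and the
bosonic partial trace is the plain sum over the labels of the last `N - M` particles
(`partialTrace_eq_tsum`).

The partial trace of a commutator is then sorted by where `β` lands. If all positions are kept, the
operator passes through the trace and yields the commutator with `ρ^{(M)}`
(`ActSummable.hasSum_traceAt_castAdd`). If all are traced, the commutator contributes nothing, by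
cyclicity (`traceAt_natAdd`). For two particles there remain the mixed positions, which give the
terms in `ρ^{(M+1)}` (`ActSummable.hasSum_crossLeft`). The right half of each commutator is the
conjugate of the left half with outer labels exchanged.

The formula so obtained, `partialTrace_opComm_two`, is applied twice: to `ρ`, and to `ρ^{(M+1)}`
with a single traced particle. The second use expresses the mixed terms as `Tr_1 {[H₂, ρ^{(M+1)}]} -
[H₂, ρ^{(M)}]`, which produces the coefficient `1 - (N - M)`. The time derivative passes through the
partial trace because the latter is a contraction in trace norm (`traceNorm_tsum_append_le`).

Convergence has two sources: positivity bounds the entries of `ρ` by its summable diagonal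
(`TraceDominated`), and the sums containing a Hamiltonian term are regroupings of the assumed
absolutely convergent mode sums (`ActSummable`). -/

/-- The multiset of the labels of a tuple. -/
def occ {ι : Type*} {N : ℕ} (x : Fin N → ι) : Multiset ι := ∑ p, {x p}

section occ
variable {ι : Type*}

theorem occ_eq_map {N : ℕ} (x : Fin N → ι) : occ x = Finset.univ.val.map x := by
  rw [← Multiset.sum_map_singleton (Finset.univ.val.map x), Multiset.map_map]
  rfl

/-- Equal counts make the fibres of `x` and `y` over each label equinumerous; bijections between the
fibres glue to a permutation of the positions. -/
theorem occ_eq_iff {N : ℕ} {x y : Fin N → ι} :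
    occ x = occ y ↔ ∃ σ : Equiv.Perm (Fin N), x = y ∘ σ := by
  classical
  constructor
  · intro h
    rw [occ_eq_map, occ_eq_map] at h
    have hc : ∀ k, Nonempty ({p // x p = k} ≃ {p // y p = k}) := by
      intro k
      rw [← Fintype.card_eq, Fintype.card_subtype, Fintype.card_subtype]
      have := congrArg (Multiset.count k) h
      rw [Multiset.count_map, Multiset.count_map] at this
      simpa [Finset.card, eq_comm] using this
    let e := fun k => Classical.choice (hc k)
    have key : ∀ z, y ((Equiv.sigmaFiberEquiv y) (Equiv.sigmaCongrRight e z)) = z.1 :=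
      fun z => (e z.1 z.2).2
    refine ⟨(Equiv.sigmaFiberEquiv x).symm.trans
      ((Equiv.sigmaCongrRight e).trans (Equiv.sigmaFiberEquiv y)), funext fun p => ?_⟩
    exact (key ((Equiv.sigmaFiberEquiv x).symm p)).symm
  · rintro ⟨σ, rfl⟩
    exact Equiv.sum_comp σ fun p => ({y p} : Multiset ι)

theorem occ_comp_perm {N : ℕ} (x : Fin N → ι) (σ : Equiv.Perm (Fin N)) : occ (x ∘ σ) = occ x :=
  occ_eq_iff.2 ⟨σ, rfl⟩

theorem occ_cons {N : ℕ} (k : ι) (x : Fin N → ι) :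
    occ (Fin.cons k x : Fin (N + 1) → ι) = {k} + occ x := by
  simp [occ, Fin.sum_univ_succ]

theorem occ_snoc {N : ℕ} (x : Fin N → ι) (k : ι) :
    occ (Fin.snoc x k : Fin (N + 1) → ι) = occ x + {k} := by
  simp [occ, Fin.sum_univ_castSucc]

theorem occ_append {M K : ℕ} (i : Fin M → ι) (y : Fin K → ι) :
    occ (Fin.append i y) = occ i + occ y := by
  simp [occ, Fin.sum_univ_add]

theorem occ_insertNth {N : ℕ} (p : Fin (N + 1)) (k : ι) (x : Fin N → ι) :
    occ (p.insertNth k x : Fin (N + 1) → ι) = {k} + occ x := by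
  simp [occ, Fin.sum_univ_succAbove _ p]

theorem occ_succAbove {N : ℕ} (x : Fin (N + 1) → ι) (p : Fin (N + 1)) :
    {x p} + occ (fun q => x (p.succAbove q)) = occ x := by
  simp [occ, Fin.sum_univ_succAbove _ p]

theorem occ_cast {N N' : ℕ} (h : N' = N) (x : Fin N → ι) : occ (x ∘ Fin.cast h) = occ x := by
  subst h; rfl

/-- The tuples agree off the range of `β`, so only the labels on that range are exchanged. The
additive form avoids truncated multiset subtraction; later uses cancel a summand. -/
theorem occ_extend {S N : ℕ} (β : Fin S ↪ Fin N) (q : Fin S → ι) (x : Fin N → ι) :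
    occ (Function.extend β q x) + occ (x ∘ β) = occ x + occ q := by
  classical
  have key : ∀ f : Fin N → ι, occ f = ∑ p ∈ (Finset.univ.map β)ᶜ, {f p} + occ (f ∘ β) := by
    intro f
    rw [occ, ← Finset.sum_compl_add_sum (Finset.univ.map β), Finset.sum_map]
    rfl
  have h1 : Function.extend β q x ∘ β = q := by
    funext s; exact β.injective.extend_apply _ _ _
  have h2 : ∑ p ∈ (Finset.univ.map β)ᶜ, ({Function.extend β q x p} : Multiset ι)
      = ∑ p ∈ (Finset.univ.map β)ᶜ, {x p} := by
    refine Finset.sum_congr rfl fun p hp => ?_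
    rw [Function.extend_apply']
    simpa using hp
  rw [key (Function.extend β q x), h1, h2, key x]
  abel

theorem occ_update {N : ℕ} (x : Fin N → ι) (a : Fin N) (k : ι) :
    occ (Function.update x a k) + {x a} = occ x + {k} := by
  classical
  simp only [occ]
  rw [← Finset.sum_compl_add_sum {a}, ← Finset.sum_compl_add_sum {a} (fun p => ({x p} : Multiset ι))]
  have : ∑ p ∈ ({a} : Finset (Fin N))ᶜ, ({Function.update x a k p} : Multiset ι)
      = ∑ p ∈ ({a} : Finset (Fin N))ᶜ, {x p} := by
    refine Finset.sum_congr rfl fun p hp => ?_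
    rw [Function.update_of_ne (by simpa using hp)]
  rw [this]
  simp [add_right_comm]

theorem IsBosonic.eq_of_occ {N : ℕ} {A : NOp ι N} (hA : IsBosonic A) {i i' j j' : Fin N → ι}
    (hi : occ i = occ i') (hj : occ j = occ j') : A i j = A i' j' := by
  obtain ⟨σ, rfl⟩ := occ_eq_iff.1 hi
  obtain ⟨τ, rfl⟩ := occ_eq_iff.1 hj
  exact hA σ τ i' j'

/-- Fock amplitudes that do not depend on the order of the labels. -/
def IsSym (Ψ : Fock ι) : Prop := ∀ N (x y : Fin N → ι), occ x = occ y → Ψ N x = Ψ N y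

theorem IsSym.annih {Ψ : Fock ι} (h : IsSym Ψ) (k : ι) : IsSym (annih k Ψ) := by
  intro N x y hxy
  simp only [BosonHierarchy.annih, LinearMap.coe_mk, AddHom.coe_mk]
  rw [h _ _ (Fin.cons k y) (by rw [occ_cons, occ_cons, hxy])]

theorem annihString_cons {S : ℕ} (k : ι) (m : Fin S → ι) :
    annihString (Fin.cons k m : Fin (S + 1) → ι) = annih k * annihString m := by
  simp [annihString, List.ofFn_succ]

theorem IsSym.annihString {S : ℕ} (m : Fin S → ι) {Ψ : Fock ι} (h : IsSym Ψ) :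
    IsSym (annihString m Ψ) := by
  induction m using Fin.consInduction with
  | elim0 => simpa [BosonHierarchy.annihString] using h
  | cons k m ih => rw [annihString_cons]; exact ih.annih k

theorem IsSym.annih_comm {Ψ : Fock ι} (h : IsSym Ψ) (k l : ι) :
    BosonHierarchy.annih k (BosonHierarchy.annih l Ψ) =
      BosonHierarchy.annih l (BosonHierarchy.annih k Ψ) := by
  funext N x
  simp only [BosonHierarchy.annih, LinearMap.coe_mk, AddHom.coe_mk]
  rw [h _ (Fin.cons l (Fin.cons k x)) (Fin.cons k (Fin.cons l x))
    (by simp only [occ_cons]; abel)]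

/-- `Fock ι` also contains amplitudes without symmetry, on which annihilators need not commute;
hence the commutation rule is stated on symmetric vectors. -/
theorem IsSym.annihString_annih {S : ℕ} (m : Fin S → ι) (k : ι) {Ψ : Fock ι} (h : IsSym Ψ) :
    BosonHierarchy.annihString m (BosonHierarchy.annih k Ψ) =
      BosonHierarchy.annih k (BosonHierarchy.annihString m Ψ) := by
  induction m using Fin.consInduction with
  | elim0 => simp [BosonHierarchy.annihString]
  | cons l m ih =>
    rw [annihString_cons, Module.End.mul_apply, ih, Module.End.mul_apply,
      (h.annihString m).annih_comm]

variable [DecidableEq ι]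

theorem IsSym.create {Ψ : Fock ι} (h : IsSym Ψ) (k : ι) : IsSym (create k Ψ) := by
  intro N x y hxy
  obtain ⟨σ, rfl⟩ := occ_eq_iff.1 hxy
  cases N with
  | zero => rfl
  | succ N =>
    simp only [BosonHierarchy.create, LinearMap.coe_mk, AddHom.coe_mk, createFun]
    congr 1
    rw [← Equiv.sum_comp σ (fun p => if y p = k then Ψ N fun q => y (p.succAbove q) else 0)]
    refine Finset.sum_congr rfl fun p _ => ?_
    simp only [Function.comp_apply]
    split_ifs
    · refine h _ _ _ (add_left_cancel (a := {y (σ p)}) ?_)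
      rw [occ_succAbove y (σ p)]
      exact (occ_succAbove (y ∘ σ) p).trans (occ_comp_perm y σ)
    · rfl

theorem createString_cons {S : ℕ} (k : ι) (n : Fin S → ι) :
    createString (Fin.cons k n : Fin (S + 1) → ι) = create k * createString n := by
  simp [createString, List.ofFn_succ]

theorem IsSym.createString {S : ℕ} (n : Fin S → ι) {Ψ : Fock ι} (h : IsSym Ψ) :
    IsSym (createString n Ψ) := by
  induction n using Fin.consInduction with
  | elim0 => simpa [BosonHierarchy.createString] using h
  | cons k m ih => rw [createString_cons]; exact ih.create k

omit [DecidableEq ι] in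
theorem isSym_vacuum : IsSym (vacuum ι) := by
  intro N x y _
  cases N <;> rfl

theorem isSym_ket {N : ℕ} (i : Fin N → ι) : IsSym (ket i) := by
  intro L x y h
  simp only [ket, Pi.smul_apply]
  rw [isSym_vacuum.createString i L x y h]

end occ
/-! ## Matrix elements of normally ordered strings -/

section strings
variable {ι : Type*}

/-- The embedding with first value `p` whose other values are those of `β`, shifted past `p`. -/
def embCons {S N : ℕ} (z : Fin (N + 1) × (Fin S ↪ Fin N)) : Fin (S + 1) ↪ Fin (N + 1) where
  toFun := Fin.cons z.1 fun s => z.1.succAbove (z.2 s)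
  inj' := by
    rw [Fin.cons_injective_iff]
    exact ⟨by rintro ⟨s, hs⟩; exact Fin.succAbove_ne _ _ hs,
      Fin.succAbove_right_injective.comp z.2.injective⟩

/-- Injectivity suffices, since both sides have `(N + 1) * N.descFactorial S` elements. This is the
induction step for sums over embeddings. -/
theorem embCons_bijective (S N : ℕ) :
    Function.Bijective (embCons : Fin (N + 1) × (Fin S ↪ Fin N) → (Fin (S + 1) ↪ Fin (N + 1))) := by
  rw [Fintype.bijective_iff_injective_and_card]
  constructor
  · rintro ⟨p, β⟩ ⟨p', β'⟩ h
    obtain rfl : p = p' := DFunLike.congr_fun h 0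
    congr 1
    ext s : 1
    exact Fin.succAbove_right_injective (DFunLike.congr_fun h s.succ)
  · simp [Fintype.card_embedding_eq, Nat.succ_descFactorial_succ, -Nat.descFactorial_succ]

theorem sum_embCons {S N : ℕ} {α : Type*} [AddCommMonoid α] (f : (Fin (S + 1) ↪ Fin (N + 1)) → α) :
    ∑ β, f β = ∑ p, ∑ β, f (embCons (p, β)) := by
  rw [← Fintype.sum_prod_type' (f := fun p β => f (embCons (p, β)))]
  exact ((embCons_bijective S N).sum_comp f).symm

theorem occ_extend_embCons {S N : ℕ} (p : Fin (N + 1)) (β : Fin S ↪ Fin N) (l : ι) (q : Fin S → ι)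
    (x : Fin (N + 1) → ι) :
    occ (Function.extend (embCons (p, β)) (Fin.cons l q : Fin (S + 1) → ι) x) =
      {l} + occ (Function.extend β q fun r => x (p.succAbove r)) := by
  have h1 := occ_extend (embCons (p, β)) (Fin.cons l q : Fin (S + 1) → ι) x
  have h2 := occ_extend β q fun r => x (p.succAbove r)
  have h3 := occ_succAbove x p
  have h4 : x ∘ embCons (p, β) =
      (Fin.cons (x p) ((fun r => x (p.succAbove r)) ∘ β) : Fin (S + 1) → ι) := by
    funext s
    refine Fin.cases rfl (fun s => rfl) s
  rw [h4, occ_cons, occ_cons, ← h3] at h1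
  refine add_right_cancel (b := {x p} + occ ((fun r => x (p.succAbove r)) ∘ β)) (h1.trans ?_)
  calc _ = {x p} + {l} + (occ (fun r => x (p.succAbove r)) + occ q) := by abel
    _ = _ := by rw [← h2]; abel

variable [DecidableEq ι]

omit [DecidableEq ι] in
theorem comp_embCons_eq_iff {S N : ℕ} (p : Fin (N + 1)) (β : Fin S ↪ Fin N)
    (x : Fin (N + 1) → ι) (k : ι) (n : Fin S → ι) :
    x ∘ embCons (p, β) = (Fin.cons k n : Fin (S + 1) → ι) ↔
      x p = k ∧ (fun r => x (p.succAbove r)) ∘ β = n := by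
  constructor
  · intro h
    exact ⟨congrFun h 0, funext fun s => congrFun h s.succ⟩
  · rintro ⟨h, rfl⟩
    funext s
    refine Fin.cases h (fun s => rfl) s

theorem create_succ (k : ι) (Ψ : Fock ι) (N : ℕ) (x : Fin (N + 1) → ι) :
    create k Ψ (N + 1) x = ((Real.sqrt (N + 1) : ℂ))⁻¹ *
      ∑ p : Fin (N + 1), if x p = k then Ψ N (fun q => x (p.succAbove q)) else 0 := rfl

omit [DecidableEq ι] in
theorem annih_apply (k : ι) (Ψ : Fock ι) (N : ℕ) (x : Fin N → ι) :
    annih k Ψ N x = (Real.sqrt (N + 1) : ℂ) * Ψ (N + 1) (Fin.cons k x) := rfl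

theorem sqrt_succ_ne_zero (N : ℕ) : (Real.sqrt (N + 1) : ℂ) ≠ 0 := by
  simp only [ne_eq, Complex.ofReal_eq_zero]
  positivity

/-- `a†_{n_1} ⋯ a†_{n_S} a_{m_1} ⋯ a_{m_S}` replaces labels `n` by `m`, at all positions. -/
theorem normalString_apply {S : ℕ} (n m : Fin S → ι) {Ψ : Fock ι} (h : IsSym Ψ) (N : ℕ)
    (x : Fin N → ι) :
    normalString n m Ψ N x =
      ∑ β : Fin S ↪ Fin N, if x ∘ β = n then Ψ N (Function.extend β m x) else 0 := by
  induction S generalizing N Ψ with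
  | zero =>
    have : ∀ β : Fin 0 ↪ Fin N, Function.extend β m x = x := fun β => by
      funext p
      exact Function.extend_apply' _ _ _ (by simp)
    have h0 : ∀ β : Fin 0 ↪ Fin N, x ∘ β = n := fun β => Subsingleton.elim _ _
    simp only [this, h0, if_true]
    simp [normalString, createString, annihString]
  | succ S ih =>
    obtain ⟨k, n, rfl⟩ : ∃ k n', n = (Fin.cons k n' : Fin (S + 1) → ι) :=
      ⟨n 0, Fin.tail n, (Fin.cons_self_tail n).symm⟩
    obtain ⟨l, m, rfl⟩ : ∃ k n', m = (Fin.cons k n' : Fin (S + 1) → ι) :=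
      ⟨m 0, Fin.tail m, (Fin.cons_self_tail m).symm⟩
    -- The first annihilator is moved next to `Ψ`, so that the induction hypothesis applies to
    -- `annih l Ψ`. Its factor `√(N + 1)` then cancels the one from `create k`.
    have h1 : normalString (Fin.cons k n : Fin (S + 1) → ι) (Fin.cons l m : Fin (S + 1) → ι) Ψ =
        create k (normalString n m (annih l Ψ)) := by
      simp only [normalString, createString_cons, annihString_cons, Module.End.mul_apply,
        h.annihString_annih]
    rw [h1]
    cases N with
    | zero =>
      rw [Finset.univ_eq_empty_iff.2 ⟨fun β => (β 0).elim0⟩]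
      rfl
    | succ N =>
      rw [create_succ, sum_embCons, Finset.mul_sum]
      refine Finset.sum_congr rfl fun p _ => ?_
      rw [ih _ _ (h.annih l)]
      simp only [comp_embCons_eq_iff]
      by_cases hp : x p = k
      · rw [if_pos hp, Finset.mul_sum]
        refine Finset.sum_congr rfl fun β _ => ?_
        by_cases hβ : (fun r => x (p.succAbove r)) ∘ β = n
        · rw [if_pos hβ, if_pos ⟨hp, hβ⟩, annih_apply, inv_mul_cancel_left₀ (sqrt_succ_ne_zero N)]
          exact h _ _ _ (by rw [occ_extend_embCons, occ_cons])
        · rw [if_neg hβ, if_neg (fun hh => hβ hh.2), mul_zero]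
      · simp [hp]

/-- Each creator chooses the position of its label, and the factors `1/√(N + 1)` multiply up to
`1/√N!`. -/
theorem createString_vacuum {S : ℕ} (n : Fin S → ι) (N : ℕ) (x : Fin N → ι) :
    createString n (vacuum ι) N x = ((Real.sqrt N.factorial : ℂ))⁻¹ *
      if S = N then ∑ β : Fin S ↪ Fin N, if x ∘ β = n then 1 else 0 else 0 := by
  induction S generalizing N with
  | zero =>
    cases N with
    | zero => simp [createString, vacuum, Subsingleton.elim _ n]
    | succ N => simp [createString, vacuum]
  | succ S ih =>
    obtain ⟨k, n, rfl⟩ : ∃ k n', n = (Fin.cons k n' : Fin (S + 1) → ι) :=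
      ⟨n 0, Fin.tail n, (Fin.cons_self_tail n).symm⟩
    rw [createString_cons, Module.End.mul_apply]
    cases N with
    | zero => simp [create, createFun]
    | succ N =>
      rw [create_succ, Nat.factorial_succ]
      push_cast
      rw [Real.sqrt_mul (by positivity)]
      push_cast
      rw [mul_inv, mul_assoc]
      congr 1
      by_cases hS : S = N
      · subst hS
        rw [if_pos rfl, sum_embCons, Finset.mul_sum]
        refine Finset.sum_congr rfl fun p _ => ?_
        simp only [comp_embCons_eq_iff, ih, if_true]
        by_cases hp : x p = k <;> simp [hp]
      · simp [ih, hS]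

/-- The amplitude of a symmetrized state, `(N!)^{-1} ∑_σ δ_{x ∘ σ, i}`. -/
noncomputable def symKet {N : ℕ} (x i : Fin N → ι) : ℂ :=
  (N.factorial : ℂ)⁻¹ * ∑ σ : Equiv.Perm (Fin N), if i = x ∘ σ then 1 else 0

theorem ket_apply {N : ℕ} (i x : Fin N → ι) : ket i N x = symKet x i := by
  simp only [ket, Pi.smul_apply, createString_vacuum, smul_eq_mul, if_true, symKet, ← mul_assoc]
  rw [← mul_inv, ← Complex.ofReal_mul, Real.mul_self_sqrt (by positivity)]
  congr 1
  refine (Fintype.sum_equiv (Equiv.embeddingEquivOfFinite (Fin N)) _ _ fun β => ?_)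
  congr 1
  have : ⇑(Equiv.embeddingEquivOfFinite (Fin N) β) = β := by
    ext p; simp [Equiv.embeddingEquivOfFinite, Function.Embedding.equivOfFiniteSelfEmbedding]
  rw [this, eq_comm (a := i)]

theorem ket_apply_of_ne {N L : ℕ} (h : N ≠ L) (i : Fin N → ι) (x : Fin L → ι) : ket i L x = 0 := by
  simp [ket, createString_vacuum, h]

theorem symKet_of_occ {N : ℕ} {x y i j : Fin N → ι} (h : occ x = occ y) (hij : occ i = occ j) :
    symKet x i = symKet y j := by
  obtain ⟨σ, rfl⟩ := occ_eq_iff.1 h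
  obtain ⟨τ, rfl⟩ := occ_eq_iff.1 hij
  simp only [symKet]
  congr 1
  refine Fintype.sum_equiv ((Equiv.mulLeft σ).trans (Equiv.mulRight τ⁻¹)) _ _ fun ρ => ?_
  congr 1
  refine propext ⟨fun hh => ?_, fun hh => ?_⟩
  · funext p
    have := congrFun hh (τ⁻¹ p)
    simpa using this
  · funext p
    have := congrFun hh (τ p)
    simpa using this

theorem isSym_symKet {N : ℕ} (i : Fin N → ι) {x y : Fin N → ι} (h : occ x = occ y) :
    symKet x i = symKet y i := symKet_of_occ h rfl

theorem symKet_comm {N : ℕ} (x i : Fin N → ι) : symKet x i = symKet i x := by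
  simp only [symKet]
  congr 1
  refine Fintype.sum_equiv (Equiv.inv _) _ _ fun σ => ?_
  congr 1
  refine propext ⟨fun hh => ?_, fun hh => ?_⟩
  · subst hh; funext p; simp
  · subst hh; funext p; simp

theorem star_symKet {N : ℕ} (x i : Fin N → ι) : star (symKet x i) = symKet x i := by
  simp only [symKet, star_mul', star_sum, star_inv₀, star_natCast]
  congr 1
  refine Finset.sum_congr rfl fun σ _ => ?_
  split_ifs <;> simp

/-- A series over a graph. -/
theorem hasSum_graph {α β E : Type*} [DecidableEq β] [AddCommMonoid E] [TopologicalSpace E]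
    (φ : α → β) {g : α → E} {a : E} (h : HasSum g a) :
    HasSum (fun z : α × β => if z.2 = φ z.1 then g z.1 else 0) a := by
  have hinj : Function.Injective fun q : α => (q, φ q) := fun q q' hq => (Prod.mk.inj hq).1
  rw [← hinj.hasSum_iff]
  · simpa [Function.comp_def] using h
  · rintro ⟨q, k⟩ hk
    rw [if_neg]
    intro h
    exact hk ⟨q, Prod.ext rfl h.symm⟩

/-- Symmetrization of the values of a function, along a series. -/
theorem hasSum_symKet_prod {α : Type*} {N : ℕ} (e : α → Fin N → ι) {g : α → ℂ} {a : ℂ}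
    (h : HasSum g a) : HasSum (fun z : α × (Fin N → ι) => g z.1 * symKet (e z.1) z.2) a := by
  have h1 := (hasSum_sum (s := Finset.univ) fun (σ : Equiv.Perm (Fin N)) _ =>
    hasSum_graph (fun q => e q ∘ σ) h).mul_left ((N.factorial : ℂ)⁻¹)
  rw [Finset.sum_const, Finset.card_univ, Fintype.card_perm, Fintype.card_fin, nsmul_eq_mul,
    inv_mul_cancel_left₀ (by exact_mod_cast N.factorial_ne_zero)] at h1
  refine h1.congr_fun fun z => ?_
  rw [symKet, mul_left_comm, Finset.mul_sum]
  simp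

/-- Symmetrized states reproduce symmetric functions. -/
theorem hasSum_symKet_mul {N : ℕ} (x : Fin N → ι) {f : (Fin N → ι) → ℂ}
    (hf : ∀ y y', occ y = occ y' → f y = f y') : HasSum (fun k => symKet x k * f k) (f x) := by
  have h := hasSum_symKet_prod (fun _ : Unit => x) (hasSum_unique fun _ : Unit => f x)
  rw [← (Equiv.punitProd (Fin N → ι)).symm.hasSum_iff] at h
  refine h.congr_fun ?_
  intro k
  simp only [Function.comp_apply, Equiv.punitProd_symm_apply]
  by_cases hk : occ k = occ x
  · rw [hf _ _ hk, mul_comm]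
  · have : symKet x k = 0 := by
      rw [symKet, Finset.sum_eq_zero, mul_zero]
      intro σ _
      rw [if_neg]
      rintro rfl
      exact hk (occ_comp_perm x σ)
    simp [this]

/-- The ket vanishes in all other sectors, and within its own it acts as the kernel of the
symmetrizer, which reproduces symmetric amplitudes. -/
theorem braket_ket {N : ℕ} (i : Fin N → ι) {Ψ : Fock ι} (h : IsSym Ψ) :
    braket (ket i) Ψ = Ψ N i := by
  have h1 := hasSum_symKet_mul i (f := Ψ N) (h N)
  have hinj : Function.Injective fun x : Fin N → ι => (⟨N, x⟩ : Σ N : ℕ, Fin N → ι) :=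
    fun _ _ h => eq_of_heq (Sigma.mk.inj h).2
  refine HasSum.tsum_eq ((hinj.hasSum_iff ?_).1 ?_)
  · rintro ⟨L, x⟩ hx
    have : N ≠ L := by
      rintro rfl
      exact hx ⟨x, rfl⟩
    simp [ket_apply_of_ne this]
  · refine h1.congr_fun fun x => ?_
    simp only [Function.comp_apply]
    rw [ket_apply, star_symKet, symKet_comm]

theorem IsSym.normalString {S : ℕ} (n m : Fin S → ι) {Ψ : Fock ι} (h : IsSym Ψ) :
    IsSym (normalString n m Ψ) := by
  rw [BosonHierarchy.normalString, Module.End.mul_apply]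
  exact (h.annihString m).createString n

theorem matrixElements_normalString {S : ℕ} (n m : Fin S → ι) (N : ℕ) (i j : Fin N → ι) :
    matrixElements N (normalString n m) i j =
      ∑ β : Fin S ↪ Fin N, if i ∘ β = n then symKet (Function.extend β m i) j else 0 := by
  rw [matrixElements, braket_ket i ((isSym_ket j).normalString n m),
    normalString_apply n m (isSym_ket j)]
  simp only [ket_apply]

theorem isBosonic_normalString {S : ℕ} (n m : Fin S → ι) (N : ℕ) :
    IsBosonic (matrixElements N (normalString n m)) := by
  intro σ τ i j
  rw [matrixElements, matrixElements, braket_ket _ ((isSym_ket _).normalString n m),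
    braket_ket _ ((isSym_ket _).normalString n m)]
  have : (ket (j ∘ τ) : Fock ι) = ket j := by
    funext L x
    by_cases h : N = L
    · subst h
      rw [ket_apply, ket_apply]
      exact symKet_of_occ rfl (occ_comp_perm j τ)
    · rw [ket_apply_of_ne h, ket_apply_of_ne h]
  rw [this]
  exact (isSym_ket j).normalString n m N _ _ (occ_comp_perm i σ)

omit [DecidableEq ι] in
theorem extend_comp_embedding {S N : ℕ} (β : Fin S ↪ Fin N) (q : Fin S → ι) (x : Fin N → ι) :
    Function.extend β q x ∘ β = q :=
  funext fun _ => β.injective.extend_apply _ _ _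

omit [DecidableEq ι] in
theorem extend_extend_embedding {S N : ℕ} (β : Fin S ↪ Fin N) (q : Fin S → ι) (x : Fin N → ι) :
    Function.extend β (x ∘ β) (Function.extend β q x) = x := by
  funext p
  by_cases hp : ∃ s, β s = p
  · obtain ⟨s, rfl⟩ := hp
    exact β.injective.extend_apply _ _ _
  · rw [Function.extend_apply' _ _ _ hp, Function.extend_apply' _ _ _ hp]

omit [DecidableEq ι] in
theorem extend_comp_perm {S N : ℕ} (β : Fin S → Fin N) (q : Fin S → ι) (x : Fin N → ι)
    (hβ : Function.Injective β) (σ : Equiv.Perm (Fin N)) :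
    Function.extend β q x ∘ σ = Function.extend (σ.symm ∘ β) q (x ∘ σ) := by
  have h' : Function.Injective (σ.symm ∘ β) := σ.symm.injective.comp hβ
  funext p
  by_cases hp : ∃ s, (σ.symm ∘ β) s = p
  · obtain ⟨s, rfl⟩ := hp
    rw [h'.extend_apply]
    simp [hβ.extend_apply]
  · rw [Function.extend_apply' _ _ _ hp, Function.comp_apply, Function.extend_apply']
    · rfl
    · rintro ⟨s, hs⟩
      exact hp ⟨s, by simp [hs]⟩

/-- Both sides count pairs `(σ, β)` that turn `i` into `j` by replacing labels and permuting. The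
replacement is undone by `σ⁻¹` with the positions `σ⁻¹ ∘ β`. -/
theorem matrixElements_normalString_comm {S : ℕ} (n m : Fin S → ι) (N : ℕ) (i j : Fin N → ι) :
    matrixElements N (normalString n m) i j = matrixElements N (normalString m n) j i := by
  rw [matrixElements_normalString, matrixElements_normalString]
  have key : ∀ (n m : Fin S → ι) (i j : Fin N → ι) (σ : Equiv.Perm (Fin N)) (β : Fin S ↪ Fin N),
      (i ∘ β = n ∧ j = Function.extend β m i ∘ σ) →
      (j ∘ (β.trans σ.symm.toEmbedding) = m ∧
        i = Function.extend (β.trans σ.symm.toEmbedding) n j ∘ σ.symm) := by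
    rintro n m i j σ β ⟨rfl, rfl⟩
    constructor
    · funext s
      simp [β.injective.extend_apply]
    · rw [extend_comp_perm _ _ _ (Function.Embedding.injective _)]
      have h1 : σ.symm.symm ∘ (β.trans σ.symm.toEmbedding) = β := by
        funext s; simp
      have h2 : (Function.extend β m i ∘ σ) ∘ σ.symm = Function.extend β m i := by
        funext s; simp
      rw [h1, h2, extend_extend_embedding]
  have hs : ∀ (n m : Fin S → ι) (i j : Fin N → ι),
      (∑ β : Fin S ↪ Fin N, if i ∘ β = n then symKet (Function.extend β m i) j else 0) =
      (N.factorial : ℂ)⁻¹ * ∑ σ : Equiv.Perm (Fin N), ∑ β : Fin S ↪ Fin N,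
        if i ∘ β = n ∧ j = Function.extend β m i ∘ σ then 1 else 0 := by
    intro n m i j
    rw [Finset.sum_comm, Finset.mul_sum]
    refine Finset.sum_congr rfl fun β _ => ?_
    by_cases h : i ∘ β = n <;> simp [h, symKet]
  rw [hs, hs]
  congr 1
  refine Fintype.sum_equiv (Equiv.inv _) _ _ fun σ => ?_
  refine Fintype.sum_equiv (Equiv.embeddingCongr (Equiv.refl _) σ.symm) _ _ fun β => ?_
  congr 1
  have e1 : Equiv.embeddingCongr (Equiv.refl _) σ.symm β = β.trans σ.symm.toEmbedding := by
    ext; simp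
  rw [e1]
  refine propext ⟨fun h => key _ _ _ _ _ _ h, fun h => ?_⟩
  have h' := key _ _ _ _ _ _ h
  have e2 : (β.trans σ.symm.toEmbedding).trans (Equiv.inv _ σ).symm.toEmbedding = β := by
    ext; simp [Equiv.Perm.inv_def]
  rw [e2] at h'
  exact h'

end strings

/-! ## Operators on particle sectors and partial traces -/

section operators
variable {ι : Type*}

/-- The summands of `A R` in which `A` acts on the particles at the positions `β`. -/
noncomputable def actAt {S N : ℕ} (A : NOp ι S) (R : NOp ι N) (β : Fin S ↪ Fin N) (x z : Fin N → ι)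
    (q : Fin S → ι) : ℂ :=
  A (x ∘ β) q * R (Function.extend β q x) z

/-- The concatenation of two tuples, as a tuple of a given length. -/
def joinTuple {N M L : ℕ} (h : N = M + L) (i : Fin M → ι) (y : Fin L → ι) : Fin N → ι :=
  Fin.append i y ∘ Fin.cast h

theorem occ_joinTuple {N M L : ℕ} (h : N = M + L) (i : Fin M → ι) (y : Fin L → ι) :
    occ (joinTuple h i y) = occ i + occ y := by
  rw [joinTuple, occ_cast, occ_append]

theorem joinTuple_injective {N M L : ℕ} (h : N = M + L) :
    Function.Injective fun z : (Fin M → ι) × (Fin L → ι) => joinTuple h z.1 z.2 := by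
  subst h
  exact (Fin.appendEquiv M L).injective

/-- Any embedding is an initial segment, up to a renumbering. -/
theorem exists_equiv_castAdd {M N L : ℕ} (h : N = M + L) (β : Fin M ↪ Fin N) :
    ∃ e : Fin (M + L) ≃ Fin N, ∀ s, e (Fin.castAdd L s) = β s := by
  classical
  have hc : Fintype.card (Fin L) = Fintype.card ↥(Set.range β)ᶜ := by
    rw [Fintype.card_compl_set, Set.card_range_of_injective β.injective]
    simp [h]
  refine ⟨finSumFinEquiv.symm.trans ((Equiv.sumCongr (Equiv.ofInjective β β.injective)
    (Fintype.equivOfCardEq hc)).trans (Equiv.Set.sumCompl (Set.range β))), fun s => ?_⟩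
  simp

variable [DecidableEq ι]

/-- Only the finitely many `q` read off from a permutation of `k` contribute. Thus `g` may be
arbitrary, as required for unbounded operators. -/
theorem summable_mul_symKet {S N : ℕ} (β : Fin S ↪ Fin N) (x k : Fin N → ι)
    (g : (Fin S → ι) → ℂ) : Summable fun q => g q * symKet (Function.extend β q x) k := by
  apply summable_of_hasFiniteSupport
  refine Set.Finite.subset (Set.finite_range fun σ : Equiv.Perm (Fin N) => k ∘ σ ∘ β) ?_
  intro q hq
  by_contra hn
  refine hq ?_
  have : symKet (Function.extend β q x) k = 0 := by
    rw [symKet, Finset.sum_eq_zero, mul_zero]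
    intro σ _
    rw [if_neg]
    intro hk
    refine hn ⟨σ⁻¹, ?_⟩
    funext s
    simp [hk, β.injective.extend_apply]
  simp [this]

/-- For given `β` the creation labels are forced to be `x ∘ β`, which collapses half of the double
sum. -/
theorem onSector_apply {S : ℕ} (A : NOp ι S) (N : ℕ) (x k : Fin N → ι) :
    onSector A N x k = (S.factorial : ℂ)⁻¹ *
      ∑ β : Fin S ↪ Fin N, ∑' q, A (x ∘ β) q * symKet (Function.extend β q x) k := by
  rw [onSector]
  congr 1
  refine HasSum.tsum_eq (HasSum.congr_fun (hasSum_sum (s := Finset.univ)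
    fun (β : Fin S ↪ Fin N) _ => (Equiv.prodComm _ _).hasSum_iff.2
      (hasSum_graph (fun _ => x ∘ β) (summable_mul_symKet β x k (A (x ∘ β))).hasSum)) ?_)
  rintro ⟨p, q⟩
  rw [matrixElements_normalString, Finset.mul_sum]
  refine Finset.sum_congr rfl fun β _ => ?_
  simp only [Function.comp_apply, Equiv.prodComm_apply, Prod.swap]
  by_cases h : x ∘ β = p
  · subst h; simp
  · have h' : p ≠ x ∘ β := Ne.symm h
    simp [h, h']

theorem isBosonic_onSector {S : ℕ} (A : NOp ι S) (N : ℕ) : IsBosonic (onSector A N) := by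
  intro σ τ i j
  simp only [onSector]
  congr 1
  refine tsum_congr fun p => ?_
  rw [isBosonic_normalString p.1 p.2 N σ τ i j]

theorem star_matrixElements_normalString {S : ℕ} (n m : Fin S → ι) (N : ℕ) (i j : Fin N → ι) :
    star (matrixElements N (normalString n m) i j) = matrixElements N (normalString n m) i j := by
  rw [matrixElements_normalString, star_sum]
  refine Finset.sum_congr rfl fun β _ => ?_
  split_ifs
  · exact star_symKet _ _
  · simp

theorem isHermitian_onSector {S : ℕ} {A : NOp ι S} (hA : A.IsHermitian) (N : ℕ) :
    (onSector A N).IsHermitian := by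
  ext i j
  rw [Matrix.conjTranspose_apply]
  simp only [onSector, star_mul', star_inv₀, star_natCast]
  congr 1
  refine tsum_star.trans ((Equiv.prodComm _ _).tsum_eq _).symm |>.trans (tsum_congr fun p => ?_)
  simp only [Equiv.prodComm_apply, Prod.swap, star_mul', star_matrixElements_normalString]
  rw [matrixElements_normalString_comm]
  exact congrArg (· * _) (hA.apply p.1 p.2)

/-- The product of an `S`-particle operator with a symmetric `N`-particle operator. -/
theorem hasSum_onSector_mul {S N : ℕ} (A : NOp ι S) {R : NOp ι N} (hR : IsBosonic R)
    (x z : Fin N → ι) (h : ∀ β : Fin S ↪ Fin N, Summable (actAt A R β x z)) :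
    HasSum (fun k => onSector A N x k * R k z)
      ((S.factorial : ℂ)⁻¹ * ∑ β : Fin S ↪ Fin N, ∑' q, actAt A R β x z q) := by
  have h1 : ∀ β : Fin S ↪ Fin N,
      HasSum (fun k => (∑' q, A (x ∘ β) q * symKet (Function.extend β q x) k) * R k z)
        (∑' q, actAt A R β x z q) := by
    intro β
    -- The joint sum over `q` and `k` converges, so it may be taken with `k` outside. Where `symKet`
    -- is nonzero, the second tuple is a permutation of `k`, and symmetry of `R` allows evaluation
    -- at `k`.
    have h2 := hasSum_symKet_prod (fun q => Function.extend β q x) (h β).hasSum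
    rw [← (Equiv.prodComm _ _).hasSum_iff] at h2
    refine h2.prod_fiberwise fun k => ?_
    refine HasSum.congr_fun ((summable_mul_symKet β x k (A (x ∘ β))).hasSum.mul_right _) ?_
    intro q
    simp only [Function.comp_apply, Equiv.prodComm_apply, Prod.swap, actAt]
    by_cases hk : occ (Function.extend β q x) = occ k
    · rw [hR.eq_of_occ hk (rfl : occ z = occ z)]; ring
    · have : symKet (Function.extend β q x) k = 0 := by
        rw [symKet, Finset.sum_eq_zero, mul_zero]
        intro σ _
        rw [if_neg]
        rintro rfl
        exact hk (occ_comp_perm _ σ).symm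
      simp [this]
  refine HasSum.congr_fun ((hasSum_sum (s := Finset.univ) fun β _ => h1 β).mul_left _) fun k => ?_
  rw [onSector_apply, mul_assoc, Finset.sum_mul]

omit [DecidableEq ι] in
theorem isBosonic_opMul {N : ℕ} {A B : NOp ι N} (hA : IsBosonic A) (hB : IsBosonic B) :
    IsBosonic (opMul A B) := by
  intro σ τ i j
  simp only [opMul]
  refine tsum_congr fun k => ?_
  have h1 := hA σ 1 i k
  have h2 := hB 1 τ k j
  simp only [Equiv.Perm.coe_one, Function.comp_id] at h1 h2
  rw [h1, h2]

omit [DecidableEq ι] in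
theorem isBosonic_opComm {N : ℕ} {A B : NOp ι N} (hA : IsBosonic A) (hB : IsBosonic B) :
    IsBosonic (opComm A B) := by
  intro σ τ i j
  simp only [opComm]
  rw [isBosonic_opMul hA hB, isBosonic_opMul hB hA]

/-- For each `β`, the tuples `x` with `x ∘ β = n` are parametrized by the labels `y` at the other
positions. After renumbering, symmetry of `X` makes all `N.descFactorial M` embeddings contribute
equally. -/
theorem hasSum_trace_normalString {N M L : ℕ} (h : N = M + L) {X : NOp ι N} (hX : IsBosonic X)
    (n m : Fin M → ι)
    (hs : Summable fun y => X (joinTuple h m y) (joinTuple h n y)) :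
    HasSum (fun x => opMul (matrixElements N (normalString n m)) X x x)
      (N.descFactorial M * ∑' y, X (joinTuple h m y) (joinTuple h n y)) := by
  have h1 : ∀ x, opMul (matrixElements N (normalString n m)) X x x =
      ∑ β : Fin M ↪ Fin N, if n = x ∘ β then X (Function.extend β m x) x else 0 := by
    intro x
    refine HasSum.tsum_eq (HasSum.congr_fun (hasSum_sum (s := Finset.univ)
      (f := fun (β : Fin M ↪ Fin N) k =>
        if n = x ∘ β then symKet (Function.extend β m x) k * X k x else 0) fun β _ => ?_) ?_)
    · by_cases hβ : n = x ∘ β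
      · simp only [if_pos hβ]
        exact hasSum_symKet_mul _ fun y y' hy => hX.eq_of_occ hy rfl
      · simp only [if_neg hβ]
        exact hasSum_zero
    · intro k
      rw [matrixElements_normalString, Finset.sum_mul]
      refine Finset.sum_congr rfl fun β _ => ?_
      by_cases hβ : n = x ∘ β
      · rw [if_pos hβ, if_pos hβ.symm]
      · rw [if_neg hβ, if_neg (Ne.symm hβ), zero_mul]
  have h2 : ∀ β : Fin M ↪ Fin N,
      HasSum (fun x => if n = x ∘ β then X (Function.extend β m x) x else 0)
        (∑' y, X (joinTuple h m y) (joinTuple h n y)) := by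
    intro β
    obtain ⟨e, he⟩ := exists_equiv_castAdd h β
    have hφ : ∀ y : Fin L → ι, (Fin.append n y ∘ e.symm) ∘ β = n := by
      intro y
      funext s
      simp only [Function.comp_apply, ← he, Equiv.symm_apply_apply, Fin.append_left]
    have hinj : Function.Injective fun y : Fin L → ι => Fin.append n y ∘ e.symm := by
      intro y y' hy
      funext l
      have := congrFun hy (e (Fin.natAdd M l))
      simpa using this
    rw [← hinj.hasSum_iff]
    · refine HasSum.congr_fun hs.hasSum fun y => ?_
      simp only [Function.comp_apply]
      have hx : occ (Fin.append n y ∘ e.symm) = occ n + occ y := by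
        rw [← occ_append]
        have h3 := occ_comp_perm (Fin.append n y ∘ Fin.cast h) ((finCongr h).trans e).symm
        rw [occ_cast] at h3
        rw [← h3]
        rfl
      rw [if_pos]
      · refine hX.eq_of_occ ?_ ?_
        · have h4 := occ_extend β m (Fin.append n y ∘ e.symm)
          rw [hφ, hx] at h4
          rw [occ_joinTuple]
          refine add_right_cancel (b := occ n) (h4.trans ?_)
          abel
        · rw [occ_joinTuple, hx]
      · exact (hφ y).symm
    · intro x hx
      rw [if_neg]
      intro hn
      refine hx ⟨fun l => x (e (Fin.natAdd M l)), ?_⟩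
      funext p
      obtain ⟨r, rfl⟩ := e.surjective p
      simp only [Function.comp_apply, Equiv.symm_apply_apply]
      refine Fin.addCases (fun s => ?_) (fun l => ?_) r
      · rw [Fin.append_left, hn, he]; rfl
      · rw [Fin.append_right]
  simp only [h1]
  have h3 := hasSum_sum (s := Finset.univ) fun (β : Fin M ↪ Fin N) _ => h2 β
  rwa [Finset.sum_const, Finset.card_univ, Fintype.card_embedding_eq, Fintype.card_fin,
    Fintype.card_fin, nsmul_eq_mul] at h3

theorem partialTraceConverges_of_summable {N M L : ℕ} (h : N = M + L) {X : NOp ι N}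
    (hX : IsBosonic X)
    (hs : ∀ i j : Fin M → ι, Summable fun y => X (joinTuple h i y) (joinTuple h j y)) :
    PartialTraceConverges M X :=
  fun n m => (hasSum_trace_normalString h hX n m (hs m n)).summable

/-- The partial trace sums over the labels of the traced particles. -/
theorem partialTrace_eq_tsum {N M L : ℕ} (h : N = M + L) {X : NOp ι N} (hX : IsBosonic X)
    (hs : ∀ i j : Fin M → ι, Summable fun y => X (joinTuple h i y) (joinTuple h j y))
    (i j : Fin M → ι) :
    partialTrace M X i j = ∑' y, X (joinTuple h i y) (joinTuple h j y) := by
  set T : (Fin M → ι) → (Fin M → ι) → ℂ :=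
    fun i j => ∑' y, X (joinTuple h i y) (joinTuple h j y) with hT
  have hTocc : ∀ i i' j j', occ i = occ i' → occ j = occ j' → T i j = T i' j' := by
    intro i i' j j' hi hj
    refine tsum_congr fun y => hX.eq_of_occ ?_ ?_ <;> simp [occ_joinTuple, hi, hj]
  have h1 : HasSum (fun p : (Fin M → ι) × (Fin M → ι) =>
      opTrace (opMul (matrixElements N (normalString p.1 p.2)) X) *
        matrixElements M (normalString p.2 p.1) i j)
      (∑ _β : Fin M ↪ Fin M, N.descFactorial M * T i j) := by
    refine HasSum.congr_fun (hasSum_sum (s := Finset.univ)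
      (f := fun (β : Fin M ↪ Fin M) (p : (Fin M → ι) × (Fin M → ι)) =>
        if p.2 = i ∘ β then N.descFactorial M * (symKet j p.1 * T (i ∘ β) p.1) else 0)
      fun β _ => ?_) ?_
    · have hβ : occ (i ∘ β) = occ i := occ_comp_perm i (Equiv.embeddingEquivOfFinite _ β) ▸ rfl
      refine hasSum_graph (fun _ => i ∘ β)
        (g := fun n => N.descFactorial M * (symKet j n * T (i ∘ β) n)) ?_
      refine HasSum.mul_left _ ?_
      rw [hTocc i (i ∘ β) j j hβ.symm rfl]
      exact hasSum_symKet_mul j fun y y' hy => hTocc _ _ _ _ rfl hy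
    · rintro ⟨n, m⟩
      rw [matrixElements_normalString, Finset.mul_sum]
      refine Finset.sum_congr rfl fun β _ => ?_
      by_cases hm : m = i ∘ β
      · subst hm
        have hβ : occ (i ∘ β) = occ i := occ_comp_perm i (Equiv.embeddingEquivOfFinite _ β) ▸ rfl
        simp only [if_true]
        have ht : opTrace (opMul (matrixElements N (normalString n (i ∘ β))) X) =
            N.descFactorial M * T (i ∘ β) n :=
          (hasSum_trace_normalString h hX n (i ∘ β) (hs _ _)).tsum_eq
        have hn : occ (Function.extend β n i) = occ n := by
          have := occ_extend β n i
          rw [hβ, add_comm (occ i)] at this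
          exact add_right_cancel this
        rw [ht, isSym_symKet j hn, symKet_comm]
        ring
      · rw [if_neg hm, if_neg (Ne.symm hm), mul_zero]
  -- The `M!` self-embeddings of `Fin M` cancel `1/M!`, and `N.descFactorial M` cancels `(N -
  -- M)!/N!`.
  rw [partialTrace, h1.tsum_eq, Finset.sum_const, Finset.card_univ, Fintype.card_embedding_eq,
    Fintype.card_fin, Nat.descFactorial_self, nsmul_eq_mul]
  have h2 : ((N - M).factorial : ℂ) * N.descFactorial M = N.factorial := by
    exact_mod_cast Nat.factorial_mul_descFactorial (by omega : M ≤ N)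
  have h3 : (N.factorial : ℂ) ≠ 0 := by exact_mod_cast N.factorial_ne_zero
  have h4 : (M.factorial : ℂ) ≠ 0 := by exact_mod_cast M.factorial_ne_zero
  field_simp
  rw [← h2]

theorem partialTrace_eq_zero {N M : ℕ} (h : N < M) (X : NOp ι N) : partialTrace M X = 0 := by
  funext i j
  have h1 : ∀ n m : Fin M → ι, matrixElements N (normalString n m) = 0 := by
    intro n m
    funext x z
    have : IsEmpty (Fin M ↪ Fin N) :=
      Function.Embedding.isEmpty_of_card_lt (by simpa using h)
    rw [matrixElements_normalString, Finset.univ_eq_empty, Finset.sum_empty]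
    rfl
  simp [partialTrace, h1, opMul, opTrace]

theorem isBosonic_partialTrace {N : ℕ} (M : ℕ) (X : NOp ι N) : IsBosonic (partialTrace M X) := by
  intro σ τ i j
  simp only [partialTrace]
  congr 1
  refine tsum_congr fun p => ?_
  rw [isBosonic_normalString]

end operators

/-! ## Reduced operators of a trace class operator -/

section reduction
variable {ι : Type*}

/-- The matrix elements are dominated by those of a positive diagonal operator of finite trace. -/
def TraceDominated {N : ℕ} (R : NOp ι N) : Prop :=
  ∃ w : (Fin N → ι) → ℝ, Summable w ∧ ∀ x z, ‖R x z‖ ≤ w x + w z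

/-- Nonnegativity of the `2 × 2` principal minors gives `|R x z|² ≤ R x x * R z z ≤ (R x x + R z
z)²`; the trace makes the diagonal summable. -/
theorem IsDensityOperator.traceDominated {N : ℕ} {R : NOp ι N} (hR : IsDensityOperator R) :
    TraceDominated R := by
  refine ⟨fun x => (R x x).re, (Complex.hasSum_re hR.trace_one).summable, fun x z => ?_⟩
  have h1 := (hR.posSemidef.submatrix ![x, z]).det_nonneg
  have hx : 0 ≤ R x x := hR.posSemidef.diag_nonneg
  have hz : 0 ≤ R z z := hR.posSemidef.diag_nonneg
  rw [Complex.le_def] at hx hz h1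
  simp only [Matrix.det_fin_two, Matrix.submatrix_apply, Matrix.cons_val_zero,
    Matrix.cons_val_one, Complex.zero_re, Complex.sub_re] at h1 hx hz
  have h2 : R z x = star (R x z) := (hR.posSemidef.isHermitian.apply z x).symm
  have h3 : (R x z * R z x).re = ‖R x z‖ ^ 2 := by
    rw [h2, Complex.star_def, Complex.mul_conj, Complex.ofReal_re, Complex.normSq_eq_norm_sq]
  rw [h3, Complex.mul_re, ← hx.2, ← hz.2] at h1
  simp only [Complex.zero_im, mul_zero, sub_zero] at h1
  refine abs_le_of_sq_le_sq' ?_ (add_nonneg hx.1 hz.1) |>.2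
  nlinarith [h1.1, hx.1, hz.1, mul_nonneg hx.1 hz.1]

theorem TraceDominated.summable_comp {N : ℕ} {R : NOp ι N} (hR : TraceDominated R) {α : Type*}
    {e f : α → Fin N → ι} (he : Function.Injective e) (hf : Function.Injective f) :
    Summable fun a => R (e a) (f a) := by
  obtain ⟨w, hw, hR⟩ := hR
  exact Summable.of_norm_bounded ((hw.comp_injective he).add (hw.comp_injective hf))
    fun a => hR _ _

theorem joinTuple_right_injective {N M L : ℕ} (h : N = M + L) (i : Fin M → ι) :
    Function.Injective fun y : Fin L → ι => joinTuple h i y :=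
  fun y y' hy => (Prod.mk.inj (joinTuple_injective h (a₁ := (i, y)) (a₂ := (i, y')) hy)).2

theorem TraceDominated.summable_joinTuple {N M L : ℕ} {R : NOp ι N} (hR : TraceDominated R)
    (h : N = M + L) (i j : Fin M → ι) :
    Summable fun y => R (joinTuple h i y) (joinTuple h j y) :=
  hR.summable_comp (joinTuple_right_injective h i) (joinTuple_right_injective h j)

variable [DecidableEq ι]

theorem isHermitian_partialTrace {N M L : ℕ} (h : N = M + L) {R : NOp ι N} (hb : IsBosonic R)
    (hR : R.IsHermitian)
    (hs : ∀ i j : Fin M → ι, Summable fun y => R (joinTuple h i y) (joinTuple h j y)) :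
    (partialTrace M R).IsHermitian := by
  ext i j
  rw [Matrix.conjTranspose_apply, partialTrace_eq_tsum h hb hs, partialTrace_eq_tsum h hb hs,
    tsum_star]
  exact tsum_congr fun y => hR.apply _ _

/-- The dominating weight of the reduced operator is the marginal of the original weight. -/
theorem TraceDominated.reduce {N M L : ℕ} (h : N = M + L) {R : NOp ι N} (hb : IsBosonic R)
    (hR : TraceDominated R) : TraceDominated (partialTrace M R) := by
  have hs := hR.summable_joinTuple h
  obtain ⟨w, hw, hR⟩ := hR
  have hw1 := hw.comp_injective (joinTuple_injective h)
  refine ⟨fun u => ∑' y, w (joinTuple h u y), hw1.prod, fun x z => ?_⟩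
  have hx : Summable fun y => w (joinTuple h x y) := hw.comp_injective (joinTuple_right_injective h x)
  have hz : Summable fun y => w (joinTuple h z y) := hw.comp_injective (joinTuple_right_injective h z)
  rw [partialTrace_eq_tsum h hb hs]
  simp only
  rw [← hx.tsum_add hz]
  exact tsum_of_norm_bounded (hx.add hz).hasSum fun y => hR _ _

/-- Partial traces can be taken in two steps. -/
theorem partialTrace_partialTrace {N M A B : ℕ} (h : N = M + A + B) {R : NOp ι N}
    (hb : IsBosonic R) (hR : TraceDominated R) :
    partialTrace M (partialTrace (M + A) R) = partialTrace M R := by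
  have h' : N = M + (A + B) := by omega
  funext i j
  rw [partialTrace_eq_tsum (L := A) rfl (isBosonic_partialTrace _ _)
    ((hR.reduce h hb).summable_joinTuple rfl),
    partialTrace_eq_tsum h' hb (hR.summable_joinTuple h')]
  have h1 := (hR.summable_joinTuple h' i j)
  rw [← (Fin.appendEquiv A B).summable_iff] at h1
  rw [← (Fin.appendEquiv A B).tsum_eq]
  refine (tsum_congr fun l => ?_).trans h1.tsum_prod.symm
  rw [partialTrace_eq_tsum h hb (hR.summable_joinTuple h)]
  have hocc : ∀ (u : Fin M → ι) (y : Fin B → ι),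
      occ (joinTuple h (joinTuple rfl u l) y) = occ (joinTuple h' u (Fin.append l y)) :=
    fun u y => by simp only [occ_joinTuple, occ_append, add_assoc]
  exact tsum_congr fun y => hb.eq_of_occ (hocc i y) (hocc j y)

/-! ### Traces of operators acting at chosen positions -/

/-- The absolute convergence of the mode sums in `Tr {A R}`, for all positions on which the
operator `A` acts. -/
def ActSummable {S M K : ℕ} (A : NOp ι S) (R : NOp ι (M + K)) : Prop :=
  ∀ (β : Fin S ↪ Fin (M + K)) (i j : Fin M → ι),
    Summable fun p : (Fin K → ι) × (Fin S → ι) =>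
      actAt A R β (Fin.append i p.1) (Fin.append j p.1) p.2

omit [DecidableEq ι] in
theorem actAt_perm {S N : ℕ} {A : NOp ι S} (hA : IsBosonic A) (R : NOp ι N) (β : Fin S ↪ Fin N)
    (τ : Equiv.Perm (Fin S)) (x z : Fin N → ι) (q : Fin S → ι) :
    actAt A R (τ.toEmbedding.trans β) x z (q ∘ τ) = actAt A R β x z q := by
  have h1 : x ∘ (τ.toEmbedding.trans β) = (x ∘ β) ∘ τ := rfl
  have h2 : Function.extend (τ.toEmbedding.trans β) (q ∘ τ) x = Function.extend β q x := by
    funext p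
    by_cases hp : ∃ s, β s = p
    · obtain ⟨s, rfl⟩ := hp
      obtain ⟨s, rfl⟩ := τ.surjective s
      rw [β.injective.extend_apply]
      exact (τ.toEmbedding.trans β).injective.extend_apply _ _ s
    · rw [Function.extend_apply' _ _ _ hp, Function.extend_apply']
      rintro ⟨s, hs⟩
      exact hp ⟨τ s, hs⟩
  rw [actAt, actAt, h1, h2, hA]

-- The assumption speaks of increasing positions only. Sorting writes any embedding as an increasing
-- one up to a permutation, which merely renames the inner labels.
omit [DecidableEq ι] in
theorem ModeSumsConverge.actSummable {S M K : ℕ} {A : NOp ι S} (hA : IsBosonic A)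
    {R : NOp ι (M + K)} (h : ModeSumsConverge M K A R) : ActSummable A R := by
  intro β i j
  let τ : Equiv.Perm (Fin S) := Tuple.sort β
  have hm : StrictMono (β ∘ τ) :=
    (Tuple.monotone_sort β).strictMono_of_injective (β.injective.comp τ.injective)
  let α : Fin S ↪o Fin (M + K) := OrderEmbedding.ofStrictMono (β ∘ τ) hm
  have hα : (α : Fin S → Fin (M + K)) = (τ.toEmbedding.trans β) := rfl
  have h1 := h α i j
  rw [← (Equiv.prodCongrRight fun _ : Fin K → ι => Equiv.arrowCongr τ.symm (Equiv.refl ι)).summable_iff]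
    at h1
  refine h1.congr fun p => ?_
  rw [← actAt_perm hA R β τ]
  rfl

/-- The trace of the summands of `A R` in which `A` acts at the positions `β`. -/
noncomputable def traceAt {S M K : ℕ} (A : NOp ι S) (R : NOp ι (M + K))
    (β : Fin S ↪ Fin (M + K)) (i j : Fin M → ι) : ℂ :=
  ∑' p : (Fin K → ι) × (Fin S → ι), actAt A R β (Fin.append i p.1) (Fin.append j p.1) p.2

omit [DecidableEq ι] in
theorem traceAt_perm {S M K : ℕ} {A : NOp ι S} (hA : IsBosonic A) (R : NOp ι (M + K))
    (β : Fin S ↪ Fin (M + K)) (τ : Equiv.Perm (Fin S)) (i j : Fin M → ι) :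
    traceAt A R (τ.toEmbedding.trans β) i j = traceAt A R β i j := by
  rw [traceAt, ← (Equiv.prodCongrRight
    fun _ : Fin K → ι => Equiv.arrowCongr τ.symm (Equiv.refl ι)).tsum_eq]
  exact tsum_congr fun p => actAt_perm hA R β τ _ _ _

section
variable {S M K : ℕ} {A : NOp ι S} {R : NOp ι (M + K)}

theorem ActSummable.hasSum_onSector_mul_append (h : ActSummable A R) (hb : IsBosonic R)
    (i j : Fin M → ι) (y : Fin K → ι) :
    HasSum (fun k => onSector A (M + K) (Fin.append i y) k * R k (Fin.append j y))
      ((S.factorial : ℂ)⁻¹ * ∑ β : Fin S ↪ Fin (M + K),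
        ∑' q, actAt A R β (Fin.append i y) (Fin.append j y) q) :=
  hasSum_onSector_mul A hb _ _ fun β => (h β i j).prod_factor y

theorem ActSummable.hasSum_onSector_mul (h : ActSummable A R) (hb : IsBosonic R)
    (i j : Fin M → ι) :
    HasSum (fun y => opMul (onSector A (M + K)) R (Fin.append i y) (Fin.append j y))
      ((S.factorial : ℂ)⁻¹ * ∑ β : Fin S ↪ Fin (M + K), traceAt A R β i j) := by
  have h1 := (hasSum_sum (s := Finset.univ) fun (β : Fin S ↪ Fin (M + K)) _ =>
    (h β i j).hasSum.prod_fiberwise fun y => ((h β i j).prod_factor y).hasSum).mul_left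
      ((S.factorial : ℂ)⁻¹)
  exact h1.congr_fun fun y => (h.hasSum_onSector_mul_append hb i j y).tsum_eq

omit [DecidableEq ι] in
theorem hermitian_mul_apply {N : ℕ} {A B : NOp ι N} (hA : A.IsHermitian) (hB : B.IsHermitian)
    (x z k : Fin N → ι) : A x k * B k z = star (B z k * A k x) := by
  rw [star_mul', hA.apply, hB.apply, mul_comm]

-- By this conjugation only products with the Hamiltonian on the left have to be computed.
omit [DecidableEq ι] in
theorem opMul_eq_star {N : ℕ} {A B : NOp ι N} (hA : A.IsHermitian) (hB : B.IsHermitian)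
    (x z : Fin N → ι) : opMul A B x z = star (opMul B A z x) := by
  rw [opMul, opMul, tsum_star]
  exact tsum_congr fun k => hermitian_mul_apply hA hB x z k

omit [DecidableEq ι] in
theorem commConverges_of_summable {N : ℕ} {A B : NOp ι N} (hA : A.IsHermitian)
    (hB : B.IsHermitian) {x z : Fin N → ι} (h1 : Summable fun k => A x k * B k z)
    (h2 : Summable fun k => A z k * B k x) : CommConverges A B x z :=
  ⟨h1, h2.star.congr fun k => (hermitian_mul_apply hB hA x z k).symm⟩

theorem ActSummable.commConverges (h : ActSummable A R) (hb : IsBosonic R)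
    (hA : A.IsHermitian) (hR : R.IsHermitian) (i j : Fin M → ι) (y : Fin K → ι) :
    CommConverges (onSector A (M + K)) R (Fin.append i y) (Fin.append j y) :=
  commConverges_of_summable (isHermitian_onSector hA _) hR
    (h.hasSum_onSector_mul_append hb i j y).summable (h.hasSum_onSector_mul_append hb j i y).summable

theorem ActSummable.hasSum_opComm (h : ActSummable A R) (hb : IsBosonic R)
    (hA : A.IsHermitian) (hR : R.IsHermitian) (i j : Fin M → ι) :
    HasSum (fun y => opComm (onSector A (M + K)) R (Fin.append i y) (Fin.append j y))
      ((S.factorial : ℂ)⁻¹ * ∑ β : Fin S ↪ Fin (M + K),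
        (traceAt A R β i j - star (traceAt A R β j i))) := by
  have h1 := h.hasSum_onSector_mul hb i j
  have h2 := (h.hasSum_onSector_mul hb j i).star
  have h3 := (h1.sub h2).congr_fun (g := fun y =>
    opComm (onSector A (M + K)) R (Fin.append i y) (Fin.append j y)) fun y => by
      rw [opComm, opMul_eq_star hR (isHermitian_onSector hA _)]
  simpa only [star_mul', star_inv₀, star_natCast, star_sum, ← mul_sub, ← Finset.sum_sub_distrib]
    using h3

theorem ActSummable.partialTraceConverges (h : ActSummable A R) (hb : IsBosonic R)
    (hA : A.IsHermitian) (hR : R.IsHermitian) :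
    PartialTraceConverges M (opComm (onSector A (M + K)) R) :=
  partialTraceConverges_of_summable (L := K) rfl (isBosonic_opComm (isBosonic_onSector A _) hb)
    fun i j => (h.hasSum_opComm hb hA hR i j).summable

theorem ActSummable.partialTrace_opComm (h : ActSummable A R) (hb : IsBosonic R)
    (hA : A.IsHermitian) (hR : R.IsHermitian) (i j : Fin M → ι) :
    partialTrace M (opComm (onSector A (M + K)) R) i j = (S.factorial : ℂ)⁻¹ *
      ∑ β : Fin S ↪ Fin (M + K), (traceAt A R β i j - star (traceAt A R β j i)) :=
  (partialTrace_eq_tsum (L := K) rfl (isBosonic_opComm (isBosonic_onSector A _) hb)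
    (fun i j => (h.hasSum_opComm hb hA hR i j).summable) i j).trans
    (h.hasSum_opComm hb hA hR i j).tsum_eq

omit [DecidableEq ι] in
/-- Commutators of operators acting on the traced particles have no partial trace. -/
theorem traceAt_natAdd (hb : IsBosonic R) (hA : A.IsHermitian) (hR : R.IsHermitian)
    (β : Fin S ↪ Fin K) (i j : Fin M → ι) :
    traceAt A R (β.trans (Fin.natAddEmb M)) i j =
      star (traceAt A R (β.trans (Fin.natAddEmb M)) j i) := by
  have hcomp : ∀ (i : Fin M → ι) (y : Fin K → ι),
      Fin.append i y ∘ (β.trans (Fin.natAddEmb M)) = y ∘ β := by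
    intro i y
    funext s
    exact Fin.append_right i y (β s)
  have hocc : ∀ (i : Fin M → ι) (y : Fin K → ι) (q : Fin S → ι),
      occ (Function.extend (β.trans (Fin.natAddEmb M)) q (Fin.append i y)) =
        occ (Fin.append i (Function.extend β q y)) := by
    intro i y q
    have h1 := occ_extend (β.trans (Fin.natAddEmb M)) q (Fin.append i y)
    have h2 := occ_extend β q y
    rw [hcomp, occ_append] at h1
    refine add_right_cancel (b := occ (y ∘ β)) (h1.trans ?_)
    rw [occ_append, add_assoc, add_assoc, h2]
  -- Cyclicity of the trace: this involution exchanges the inner labels with the traced labels at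
  -- the positions `β`.
  let e : (Fin K → ι) × (Fin S → ι) ≃ (Fin K → ι) × (Fin S → ι) :=
    Function.Involutive.toPerm (fun p => (Function.extend β p.2 p.1, p.1 ∘ β)) fun p => by
      ext s
      · simp only [extend_extend_embedding]
      · simp only [extend_comp_embedding]
  rw [traceAt, traceAt, tsum_star, ← e.tsum_eq]
  refine tsum_congr fun p => ?_
  have he : e p = (Function.extend β p.2 p.1, p.1 ∘ β) := rfl
  simp only [he, actAt, star_mul', hcomp, hA.apply, hR.apply, extend_comp_embedding]
  congr 1
  refine hb.eq_of_occ ?_ ?_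
  · rw [hocc, extend_extend_embedding]
  · rw [hocc]

/-- An operator acting on the kept particles passes through the partial trace. -/
theorem ActSummable.hasSum_traceAt_castAdd (h : ActSummable A R) (hb : IsBosonic R)
    (hd : TraceDominated R) (β : Fin S ↪ Fin M) (i j : Fin M → ι) :
    HasSum (actAt A (partialTrace M R) β i j)
      (traceAt A R (β.trans (Fin.castAddEmb K)) i j) := by
  have h1 := h (β.trans (Fin.castAddEmb K)) i j
  have h2 := h1.hasSum
  rw [← (Equiv.prodComm _ _).hasSum_iff] at h2
  rw [← (Equiv.prodComm _ _).summable_iff] at h1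
  -- With the inner labels `q` fixed, the sum over the traced labels is an entry of the reduced
  -- operator.
  refine h2.prod_fiberwise fun q => ?_
  rw [actAt, partialTrace_eq_tsum (L := K) rfl hb (hd.summable_joinTuple rfl)]
  refine HasSum.congr_fun ((hd.summable_joinTuple (L := K) rfl _ _).hasSum.mul_left _) fun y => ?_
  have hcomp : Fin.append i y ∘ (β.trans (Fin.castAddEmb K)) = i ∘ β := by
    funext s
    exact Fin.append_left i y (β s)
  simp only [Function.comp_apply, Equiv.prodComm_apply, Prod.swap, actAt]
  rw [hcomp]
  congr 1
  refine hb.eq_of_occ ?_ (by rw [occ_joinTuple, occ_append])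
  have h3 := occ_extend (β.trans (Fin.castAddEmb K)) q (Fin.append i y)
  have h4 := occ_extend β q i
  rw [hcomp, occ_append] at h3
  rw [occ_joinTuple]
  refine add_right_cancel (b := occ (i ∘ β)) (h3.trans ?_)
  rw [add_right_comm, ← h4]
  abel

theorem ActSummable.hasSum_onSector_mul_partialTrace (h : ActSummable A R) (hb : IsBosonic R)
    (hd : TraceDominated R) (i j : Fin M → ι) :
    HasSum (fun k => onSector A M i k * partialTrace M R k j)
      ((S.factorial : ℂ)⁻¹ * ∑ β : Fin S ↪ Fin M,
        traceAt A R (β.trans (Fin.castAddEmb K)) i j) := by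
  have h1 := BosonHierarchy.hasSum_onSector_mul A (isBosonic_partialTrace M R) i j
    fun β => (h.hasSum_traceAt_castAdd hb hd β i j).summable
  simpa only [(h.hasSum_traceAt_castAdd hb hd _ i j).tsum_eq] using h1

theorem ActSummable.commConverges_partialTrace (h : ActSummable A R) (hb : IsBosonic R)
    (hd : TraceDominated R) (hA : A.IsHermitian) (hR : R.IsHermitian) (i j : Fin M → ι) :
    CommConverges (onSector A M) (partialTrace M R) i j :=
  commConverges_of_summable (isHermitian_onSector hA _)
    (isHermitian_partialTrace (L := K) rfl hb hR (hd.summable_joinTuple rfl))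
    (h.hasSum_onSector_mul_partialTrace hb hd i j).summable
    (h.hasSum_onSector_mul_partialTrace hb hd j i).summable

theorem ActSummable.opComm_partialTrace (h : ActSummable A R) (hb : IsBosonic R)
    (hd : TraceDominated R) (hA : A.IsHermitian) (hR : R.IsHermitian) (i j : Fin M → ι) :
    opComm (onSector A M) (partialTrace M R) i j = (S.factorial : ℂ)⁻¹ *
      ∑ β : Fin S ↪ Fin M, (traceAt A R (β.trans (Fin.castAddEmb K)) i j -
        star (traceAt A R (β.trans (Fin.castAddEmb K)) j i)) := by
  have hh := isHermitian_partialTrace (L := K) rfl hb hR (hd.summable_joinTuple rfl)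
  have h1 : ∀ i j, opMul (onSector A M) (partialTrace M R) i j = _ :=
    fun i j => (h.hasSum_onSector_mul_partialTrace hb hd i j).tsum_eq
  rw [opComm, opMul_eq_star hh (isHermitian_onSector hA _), h1, h1]
  simp only [star_mul', star_inv₀, star_natCast, star_sum, ← mul_sub, ← Finset.sum_sub_distrib]

end

/-- Here the positions lie among the first `M + A`. Summing a summable family over the last `B`
labels leaves a summable family in the rest, and these partial sums are the terms for the reduced
operator. -/
theorem ActSummable.reduce {S M A B : ℕ} {J : NOp ι S} {R : NOp ι (M + (A + B))}
    (h : ActSummable J R) (hb : IsBosonic R) (hd : TraceDominated R) :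
    ActSummable J (partialTrace (M + A) R) := by
  intro β i j
  have hN : M + (A + B) = M + A + B := (add_assoc M A B).symm
  let γ : Fin S ↪ Fin (M + (A + B)) :=
    (β.trans (Fin.castAddEmb B)).trans (finCongr hN.symm).toEmbedding
  have h1 := h γ i j
  let e : ((Fin A → ι) × (Fin S → ι)) × (Fin B → ι) ≃ (Fin (A + B) → ι) × (Fin S → ι) :=
    (Equiv.mk (fun z => ((z.1.1, z.2), z.1.2)) (fun z => ((z.1.1, z.2), z.1.2))
      (fun _ => rfl) (fun _ => rfl)).trans ((Fin.appendEquiv A B).prodCongr (Equiv.refl _))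
  rw [← e.summable_iff] at h1
  refine h1.prod.congr fun z => ?_
  obtain ⟨l, q⟩ := z
  rw [actAt, partialTrace_eq_tsum hN hb (hd.summable_joinTuple hN), ← tsum_mul_left]
  refine tsum_congr fun y => ?_
  have he : e ((l, q), y) = (Fin.append l y, q) := rfl
  have hcomp : Fin.append i (Fin.append l y) ∘ γ = Fin.append i l ∘ β := by
    funext s
    have : Fin.append i (Fin.append l y) = Fin.append (Fin.append i l) y ∘ Fin.cast hN := by
      rw [Fin.append_assoc]
      rfl
    rw [this]
    simp [γ]
  simp only [Function.comp_apply, he, actAt, hcomp]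
  congr 1
  refine hb.eq_of_occ ?_ (by simp only [occ_joinTuple, occ_append, add_assoc])
  have h3 := occ_extend γ q (Fin.append i (Fin.append l y))
  have h4 := occ_extend β q (Fin.append i l)
  rw [hcomp] at h3
  rw [occ_joinTuple]
  refine add_right_cancel (b := occ (Fin.append i l ∘ β)) ?_
  rw [h3, add_right_comm, h4]
  simp only [occ_append]
  abel

end reduction

/-! ## Partial traces of one- and two-particle commutators -/

section fewBody

theorem sum_fin_one_embedding {M K : ℕ} {E : Type*} [AddCommMonoid E]
    (F : (Fin 1 ↪ Fin (M + K)) → E) :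
    ∑ β, F β = ∑ β : Fin 1 ↪ Fin M, F (β.trans (Fin.castAddEmb K)) +
      ∑ β : Fin 1 ↪ Fin K, F (β.trans (Fin.natAddEmb M)) := by
  rw [← Function.Embedding.oneEmbeddingEquiv.symm.sum_comp F, Fin.sum_univ_add,
    ← Function.Embedding.oneEmbeddingEquiv.symm.sum_comp,
    ← Function.Embedding.oneEmbeddingEquiv.symm.sum_comp]
  rfl

/-- The embedding with values `a` in the first block and `b` in the second one. -/
def mixedEmb {M K : ℕ} (a : Fin M) (b : Fin K) : Fin 2 ↪ Fin (M + K) where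
  toFun := ![Fin.castAdd K a, Fin.natAdd M b]
  inj' := by
    have h : Fin.castAdd K a ≠ Fin.natAdd M b := by
      intro h
      have := congrArg Fin.val h
      simp only [Fin.val_castAdd, Fin.val_natAdd] at this
      omega
    intro s s' hs
    fin_cases s <;> fin_cases s' <;> simp_all [eq_comm]

/-- Two positions lie both in the first block, both in the second, or one in each, in either order.
The last order is written with a swap so that `traceAt_perm` can merge it with the other. -/
theorem sum_fin_two_embedding {M K : ℕ} {E : Type*} [AddCommMonoid E]
    (F : (Fin 2 ↪ Fin (M + K)) → E) :
    ∑ β, F β = (∑ β : Fin 2 ↪ Fin M, F (β.trans (Fin.castAddEmb K)) +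
      ∑ β : Fin 2 ↪ Fin K, F (β.trans (Fin.natAddEmb M))) +
      (∑ z : Fin M × Fin K, F (mixedEmb z.1 z.2) +
        ∑ z : Fin M × Fin K,
          F ((Equiv.swap (0 : Fin 2) 1).toEmbedding.trans (mixedEmb z.1 z.2))) := by
  let φ : ((Fin 2 ↪ Fin M) ⊕ (Fin 2 ↪ Fin K)) ⊕ ((Fin M × Fin K) ⊕ (Fin M × Fin K)) →
      (Fin 2 ↪ Fin (M + K)) := Sum.elim
    (Sum.elim (fun β => β.trans (Fin.castAddEmb K)) (fun β => β.trans (Fin.natAddEmb M)))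
    (Sum.elim (fun z => mixedEmb z.1 z.2)
      (fun z => (Equiv.swap (0 : Fin 2) 1).toEmbedding.trans (mixedEmb z.1 z.2)))
  have hφ : Function.Bijective φ := by
    rw [Fintype.bijective_iff_surjective_and_card]
    constructor
    · intro β
      have hext : ∀ γ : Fin 2 ↪ Fin (M + K), γ 0 = β 0 → γ 1 = β 1 → γ = β := by
        intro γ h0 h1
        ext s : 1
        fin_cases s
        exacts [h0, h1]
      have hne : β 0 ≠ β 1 := fun h => by simpa using β.injective h
      rcases h0 : finSumFinEquiv.symm (β 0) with a | a <;>
        rcases h1 : finSumFinEquiv.symm (β 1) with b | b <;>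
        rw [Equiv.symm_apply_eq] at h0 h1 <;>
        rw [h0, h1] at hne
      · have hab : a ≠ b := fun h => hne (by rw [h])
        exact ⟨.inl (.inl (Function.Embedding.embFinTwo hab)), hext _ h0.symm h1.symm⟩
      · exact ⟨.inr (.inl (a, b)), hext _ h0.symm h1.symm⟩
      · exact ⟨.inr (.inr (b, a)), hext _ h0.symm h1.symm⟩
      · have hab : a ≠ b := fun h => hne (by rw [h])
        exact ⟨.inl (.inr (Function.Embedding.embFinTwo hab)), hext _ h0.symm h1.symm⟩
    · have hd : ∀ n : ℕ, n.descFactorial 2 = (n - 1) * n := fun n => by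
        simp [Nat.descFactorial]
      simp only [Fintype.card_sum, Fintype.card_embedding_eq, Fintype.card_fin, Fintype.card_prod,
        hd]
      -- The case split removes the truncated subtraction in `(n - 1) * n`.
      rcases M with _ | M <;> rcases K with _ | K <;> simp
      ring
  rw [← hφ.sum_comp F, Fintype.sum_sum_type, Fintype.sum_sum_type, Fintype.sum_sum_type]
  rfl

variable {ι : Type*} [DecidableEq ι] {M K : ℕ} {R : NOp ι (M + K)}

theorem partialTrace_opComm_one {A : NOp ι 1} (h : ActSummable A R) (hb : IsBosonic R)
    (hd : TraceDominated R) (hA : A.IsHermitian) (hR : R.IsHermitian) :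
    partialTrace M (opComm (onSector A (M + K)) R) =
      opComm (onSector A M) (partialTrace M R) := by
  funext i j
  rw [h.partialTrace_opComm hb hA hR, h.opComm_partialTrace hb hd hA hR, sum_fin_one_embedding]
  have h0 : ∀ β : Fin 1 ↪ Fin K, traceAt A R (β.trans (Fin.natAddEmb M)) i j -
      star (traceAt A R (β.trans (Fin.natAddEmb M)) j i) = 0 :=
    fun β => sub_eq_zero.2 (traceAt_natAdd hb hA hR β i j)
  simp only [h0, Finset.sum_const_zero, add_zero]

variable {A : NOp ι 2}

omit [DecidableEq ι] in
theorem crossRight_eq_star {R : NOp ι (M + 1)} (hA : A.IsHermitian) (hR : R.IsHermitian)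
    (a : Fin M) (i j : Fin M → ι) (p : ι × (Fin 2 → ι)) :
    crossRight A R a i j p = star (crossLeft A R a j i p) := by
  rw [crossRight, crossLeft, star_mul', hA.apply, hR.apply, mul_comm]

/-- The label `l` at the traced position `b` is split off; summing the other traced labels leaves
`ρ^{(M+1)}`. By symmetry the series is the same for every `b`. -/
theorem ActSummable.hasSum_crossLeft (h : ActSummable A R) (hb : IsBosonic R)
    (hd : TraceDominated R) (a : Fin M) (b : Fin K) (i j : Fin M → ι) :
    HasSum (crossLeft A (partialTrace (M + 1) R) a i j) (traceAt A R (mixedEmb a b) i j) := by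
  cases K with
  | zero => exact b.elim0
  | succ L =>
  have hN : M + (L + 1) = M + 1 + L := by omega
  have h1 := (h (mixedEmb a b) i j).hasSum
  let e : (ι × (Fin 2 → ι)) × (Fin L → ι) ≃ (Fin (L + 1) → ι) × (Fin 2 → ι) :=
    (Equiv.mk (fun z => ((z.1.1, z.2), z.1.2)) (fun z => ((z.1.1, z.2), z.1.2))
      (fun _ => rfl) (fun _ => rfl)).trans
      ((Fin.insertNthEquiv (fun _ => ι) b).prodCongr (Equiv.refl _))
  rw [← e.hasSum_iff] at h1
  refine h1.prod_fiberwise fun z => ?_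
  obtain ⟨l, q⟩ := z
  rw [crossLeft, partialTrace_eq_tsum hN hb (hd.summable_joinTuple hN)]
  refine HasSum.congr_fun ((hd.summable_joinTuple hN _ _).hasSum.mul_left _) fun y => ?_
  have he : e ((l, q), y) = (b.insertNth l y, q) := rfl
  have hcomp : Fin.append i (b.insertNth l y : Fin (L + 1) → ι) ∘ mixedEmb a b = ![i a, l] := by
    funext s
    fin_cases s
    · exact Fin.append_left i _ a
    · exact (Fin.append_right i _ b).trans (Fin.insertNth_apply_same _ _ _)
  simp only [Function.comp_apply, he, actAt, hcomp]
  congr 1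
  refine hb.eq_of_occ ?_ ?_
  · have h3 := occ_extend (mixedEmb a b) q (Fin.append i (b.insertNth l y : Fin (L + 1) → ι))
    have h4 := occ_update i a (q 0)
    have h5 : occ ![i a, l] = {i a} + {l} := by simp [occ, Fin.sum_univ_two]
    have h6 : occ q = {q 0} + {q 1} := by simp [occ, Fin.sum_univ_two]
    rw [hcomp, occ_append, occ_insertNth, h5, h6] at h3
    rw [occ_joinTuple, occ_snoc]
    refine add_right_cancel (b := {i a} + {l}) (h3.trans ?_)
    calc _ = (occ i + {q 0}) + ({l} + occ y + {q 1}) := by abel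
      _ = _ := by rw [← h4]; abel
  · rw [occ_joinTuple, occ_snoc, occ_append, occ_insertNth]
    abel

theorem ActSummable.summable_crossLeft (h : ActSummable A R) (hb : IsBosonic R)
    (hd : TraceDominated R) (a : Fin M) (i j : Fin M → ι) :
    Summable (crossLeft A (partialTrace (M + 1) R) a i j) := by
  cases K with
  -- With no traced particle, `M + 1` exceeds the particle number and the reduced operator is zero.
  | zero =>
    rw [partialTrace_eq_zero (by omega)]
    exact summable_zero.congr fun p => by simp [crossLeft]
  | succ L => exact (h.hasSum_crossLeft hb hd a 0 i j).summable

theorem isHermitian_partialTrace_succ (hb : IsBosonic R)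
    (hd : TraceDominated R) (hR : R.IsHermitian) : (partialTrace (M + 1) R).IsHermitian := by
  cases K with
  | zero =>
    rw [partialTrace_eq_zero (by omega)]
    exact Matrix.isHermitian_zero
  | succ L =>
    have hN : M + (L + 1) = M + 1 + L := by omega
    exact isHermitian_partialTrace hN hb hR (hd.summable_joinTuple hN)

theorem traceDominated_partialTrace_succ (hb : IsBosonic R)
    (hd : TraceDominated R) : TraceDominated (partialTrace (M + 1) R) := by
  cases K with
  | zero =>
    rw [partialTrace_eq_zero (by omega)]
    exact ⟨0, summable_zero, by simp⟩
  | succ L => exact hd.reduce (show M + (L + 1) = M + 1 + L by omega) hb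

omit [DecidableEq ι] in
theorem actSummable_zero {S M K : ℕ} (A : NOp ι S) : ActSummable A (0 : NOp ι (M + K)) :=
  fun β i j => summable_zero.congr fun p => by simp [actAt]

theorem ActSummable.reduce_add {S : ℕ} {A : NOp ι S} (h : ActSummable A R)
    (hb : IsBosonic R) (hd : TraceDominated R) (L : ℕ) :
    ActSummable A (partialTrace (M + L) R) := by
  by_cases hK : K < L
  · rw [partialTrace_eq_zero (by omega)]
    exact actSummable_zero A
  · obtain ⟨L', rfl⟩ := Nat.exists_eq_add_of_le (not_lt.1 hK)
    exact h.reduce hb hd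

theorem ActSummable.summable_crossRight (h : ActSummable A R) (hb : IsBosonic R)
    (hd : TraceDominated R) (hA : A.IsHermitian) (hR : R.IsHermitian) (a : Fin M)
    (i j : Fin M → ι) : Summable (crossRight A (partialTrace (M + 1) R) a i j) :=
  (h.summable_crossLeft hb hd a j i).star.congr fun p =>
    (crossRight_eq_star hA (isHermitian_partialTrace_succ hb hd hR) a i j p).symm

/-- These are the terms of the action on the last two positions of `ρ^{(M+2)}`. -/
theorem ActSummable.summable_outerLeft (h : ActSummable A R) (hb : IsBosonic R)
    (hd : TraceDominated R) (i j : Fin M → ι) :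
    Summable (outerLeft A (partialTrace (M + 2) R) i j) := by
  refine (h.reduce_add hb hd 2 (Fin.natAddEmb M) i j).congr fun p => ?_
  have hcomp : Fin.append i p.1 ∘ Fin.natAddEmb M = p.1 := by
    funext s
    exact Fin.append_right i p.1 s
  rw [actAt, outerLeft, hcomp]
  congr 1
  refine (isBosonic_partialTrace _ _).eq_of_occ ?_ rfl
  have h1 := occ_extend (Fin.natAddEmb M) p.2 (Fin.append i p.1)
  rw [hcomp, occ_append] at h1
  rw [occ_append]
  refine add_right_cancel (b := occ p.1) ?_
  rw [h1]
  abel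

omit [DecidableEq ι] in
theorem outerRight_eq_outerLeft_swap {R : NOp ι (M + 2)} (i j : Fin M → ι)
    (p : (Fin 2 → ι) × (Fin 2 → ι)) : outerRight A R i j p = outerLeft A R i j p.swap :=
  mul_comm _ _

omit [DecidableEq ι] in
theorem summable_outerRight {R : NOp ι (M + 2)} {i j : Fin M → ι}
    (h : Summable (outerLeft A R i j)) : Summable (outerRight A R i j) :=
  ((Equiv.prodComm _ _).summable_iff.2 h).congr fun p =>
    (outerRight_eq_outerLeft_swap i j p).symm

-- The two series differ only by exchanging the names of the inner and the traced labels.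
omit [DecidableEq ι] in
theorem tsum_outerLeft_sub_tsum_outerRight (R : NOp ι (M + 2)) (i j : Fin M → ι) :
    ∑' p, outerLeft A R i j p - ∑' p, outerRight A R i j p = 0 := by
  rw [sub_eq_zero, ← (Equiv.prodComm _ _).tsum_eq]
  exact tsum_congr fun p => (outerRight_eq_outerLeft_swap i j p).symm

/-- The two orders of a mixed pair cancel the prefactor `1/2!`, and the `K` choices of the traced
position give the factor `K`. -/
theorem partialTrace_opComm_two (h : ActSummable A R) (hb : IsBosonic R)
    (hd : TraceDominated R) (hA : A.IsHermitian) (hAb : IsBosonic A) (hR : R.IsHermitian)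
    (i j : Fin M → ι) :
    partialTrace M (opComm (onSector A (M + K)) R) i j =
      opComm (onSector A M) (partialTrace M R) i j + (K : ℂ) * ∑ a : Fin M,
        ((∑' p, crossLeft A (partialTrace (M + 1) R) a i j p) -
          ∑' p, crossRight A (partialTrace (M + 1) R) a i j p) := by
  rw [h.partialTrace_opComm hb hA hR, h.opComm_partialTrace hb hd hA hR, sum_fin_two_embedding]
  have h0 : ∀ β : Fin 2 ↪ Fin K, traceAt A R (β.trans (Fin.natAddEmb M)) i j -
      star (traceAt A R (β.trans (Fin.natAddEmb M)) j i) = 0 :=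
    fun β => sub_eq_zero.2 (traceAt_natAdd hb hA hR β i j)
  have h1 : ∀ z : Fin M × Fin K, traceAt A R (mixedEmb z.1 z.2) i j -
      star (traceAt A R (mixedEmb z.1 z.2) j i) =
        (∑' p, crossLeft A (partialTrace (M + 1) R) z.1 i j p) -
          ∑' p, crossRight A (partialTrace (M + 1) R) z.1 i j p := by
    rintro ⟨a, b⟩
    rw [← (h.hasSum_crossLeft hb hd a b i j).tsum_eq, ← (h.hasSum_crossLeft hb hd a b j i).tsum_eq,
      tsum_star]
    congr 1
    exact tsum_congr fun p =>
      (crossRight_eq_star hA (isHermitian_partialTrace_succ hb hd hR) a i j p).symm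
  simp only [traceAt_perm hAb, h0, h1, Finset.sum_const_zero, add_zero, Fintype.sum_prod_type,
    Finset.sum_const, Finset.card_univ, Fintype.card_fin, nsmul_eq_mul, ← Finset.mul_sum]
  rw [Nat.factorial_two]
  push_cast
  ring

omit [DecidableEq ι] in
theorem CommConverges.add_smul {N : ℕ} {A B R : NOp ι N} {x z : Fin N → ι}
    (hA : CommConverges A R x z) (hB : CommConverges B R x z) (c : ℂ) :
    CommConverges (A + c • B) R x z := by
  constructor
  · refine (hA.1.add (hB.1.mul_left c)).congr fun k => ?_
    simp [add_mul, mul_assoc]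
  · refine (hA.2.add (hB.2.mul_left c)).congr fun k => ?_
    simp [mul_add, mul_left_comm]

omit [DecidableEq ι] in
theorem opComm_add_smul {N : ℕ} {A B R : NOp ι N} {x z : Fin N → ι}
    (hA : CommConverges A R x z) (hB : CommConverges B R x z) (c : ℂ) :
    opComm (A + c • B) R x z = opComm A R x z + c * opComm B R x z := by
  have h1 : opMul (A + c • B) R x z = opMul A R x z + c * opMul B R x z := by
    simp only [opMul]
    rw [← tsum_mul_left, ← hA.1.tsum_add (hB.1.mul_left c)]
    refine tsum_congr fun k => ?_
    simp [add_mul, mul_assoc]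
  have h2 : opMul R (A + c • B) x z = opMul R A x z + c * opMul R B x z := by
    simp only [opMul]
    rw [← tsum_mul_left, ← hA.2.tsum_add (hB.2.mul_left c)]
    refine tsum_congr fun k => ?_
    simp [mul_add, mul_left_comm]
  rw [opComm, opComm, opComm, h1, h2]
  ring

end fewBody

/-! ## The partial trace is a contraction in trace norm -/

section traceNorm

/-- This passes from blocks on a `Finset` to blocks on any finite injective family, here needed for
a product index. -/
theorem enorm_trace_le_traceNorm {α β : Type*} [DecidableEq α] [DecidableEq β] [Fintype β]
    (A : Matrix α α ℂ) {e : β → α} (he : Function.Injective e) (U : Matrix.unitaryGroup β ℂ) :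
    ‖Matrix.trace ((U : Matrix β β ℂ) * A.submatrix e e)‖ₑ ≤ traceNorm A := by
  let s : Finset α := Finset.univ.map ⟨e, he⟩
  let f : β ≃ s := Equiv.ofBijective (fun b => ⟨e b, by simp [s]⟩)
    ⟨fun b b' h => he (congrArg Subtype.val h), fun ⟨a, ha⟩ => by
      obtain ⟨b, _, rfl⟩ := Finset.mem_map.1 ha
      exact ⟨b, rfl⟩⟩
  let V : Matrix.unitaryGroup s ℂ := ⟨(U : Matrix β β ℂ).submatrix f.symm f.symm, by
    rw [Matrix.mem_unitaryGroup_iff, Matrix.star_eq_conjTranspose, Matrix.conjTranspose_submatrix,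
      Matrix.submatrix_mul_equiv, ← Matrix.star_eq_conjTranspose,
      (Matrix.mem_unitaryGroup_iff).1 U.2, Matrix.submatrix_one_equiv]⟩
  have hV : Matrix.trace ((V : Matrix s s ℂ) *
      A.submatrix (fun x : s => (x : α)) (fun x : s => (x : α))) =
      Matrix.trace ((U : Matrix β β ℂ) * A.submatrix e e) := by
    have h1 : A.submatrix (fun x : s => (x : α)) (fun x : s => (x : α)) =
        (A.submatrix e e).submatrix f.symm f.symm := by
      have h2 : ∀ x : s, (x : α) = e (f.symm x) := fun x =>
        congrArg Subtype.val (f.apply_symm_apply x).symm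
      ext x y
      rw [Matrix.submatrix_apply, Matrix.submatrix_apply, Matrix.submatrix_apply, h2 x, h2 y]
    rw [h1, Matrix.submatrix_mul_equiv, Matrix.trace, Matrix.trace]
    exact f.symm.sum_comp fun b => ((U : Matrix β β ℂ) * A.submatrix e e) b b
  rw [← hV]
  exact le_iSup₂ (f := fun (s : Finset α) (U : Matrix.unitaryGroup s ℂ) =>
    ‖Matrix.trace ((U : Matrix s s ℂ) *
      A.submatrix (fun x : s => (x : α)) (fun x : s => (x : α)))‖ₑ) s V

variable {ι : Type*} [DecidableEq ι] {M K : ℕ}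

/-- By duality: pairing the partial trace with a unitary `U` is the limit, over finite sets `F` of
traced labels, of pairing `X` with the unitary `U ⊗ 1_F`. -/
theorem traceNorm_tsum_append_le (X : NOp ι (M + K))
    (hs : ∀ i j : Fin M → ι, Summable fun y : Fin K → ι => X (Fin.append i y) (Fin.append j y)) :
    traceNorm (fun i j : Fin M → ι => ∑' y : Fin K → ι, X (Fin.append i y) (Fin.append j y)) ≤
      traceNorm X := by
  refine iSup₂_le fun s U => ?_
  have h1 : HasSum (fun y : Fin K → ι => ∑ a : s, ∑ b : s, (U : Matrix s s ℂ) a b *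
      X (Fin.append (b : Fin M → ι) y) (Fin.append (a : Fin M → ι) y))
      (∑ a : s, ∑ b : s, (U : Matrix s s ℂ) a b *
        ∑' y : Fin K → ι, X (Fin.append (b : Fin M → ι) y) (Fin.append (a : Fin M → ι) y)) :=
    hasSum_sum fun a _ => hasSum_sum fun b _ => (hs b a).hasSum.mul_left _
  have h2 : Matrix.trace ((U : Matrix s s ℂ) * Matrix.submatrix
      (fun i j : Fin M → ι => ∑' y : Fin K → ι, X (Fin.append i y) (Fin.append j y))
      (fun x : s => (x : Fin M → ι)) (fun x : s => (x : Fin M → ι))) =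
      ∑ a : s, ∑ b : s, (U : Matrix s s ℂ) a b *
        ∑' y : Fin K → ι, X (Fin.append (b : Fin M → ι) y) (Fin.append (a : Fin M → ι) y) := by
    simp only [Matrix.trace, Matrix.diag_apply, Matrix.mul_apply]
    rfl
  rw [h2]
  refine le_of_tendsto ((continuous_enorm.tendsto _).comp h1) (Filter.Eventually.of_forall
    fun F => ?_)
  have hV : Matrix.kroneckerMap (· * ·) (U : Matrix s s ℂ) (1 : Matrix F F ℂ) ∈
      Matrix.unitaryGroup (s × F) ℂ := Matrix.kronecker_mem_unitary U.2 (one_mem _)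
  have he : Function.Injective fun z : s × F =>
      Fin.append (z.1 : Fin M → ι) (z.2 : Fin K → ι) := by
    intro z z' h
    have := joinTuple_injective (ι := ι) (M := M) (L := K) rfl (a₁ := (z.1.1, z.2.1))
      (a₂ := (z'.1.1, z'.2.1)) h
    rw [Prod.mk.injEq] at this
    exact Prod.ext (Subtype.ext this.1) (Subtype.ext this.2)
  refine le_of_eq_of_le ?_ (enorm_trace_le_traceNorm X he ⟨_, hV⟩)
  refine congrArg (‖·‖ₑ) ?_
  simp only [Matrix.trace, Matrix.diag_apply, Matrix.mul_apply, Matrix.kroneckerMap_apply,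
    Matrix.submatrix_apply, Fintype.sum_prod_type, Matrix.one_apply]
  rw [← Finset.sum_coe_sort F, Finset.sum_comm]
  refine Finset.sum_congr rfl fun a _ => Finset.sum_congr rfl fun y _ =>
    Finset.sum_congr rfl fun b _ => ?_
  simp

theorem HasTraceDerivAt.partialTrace {ρ : ℝ → NOp ι (M + K)} {D : NOp ι (M + K)} {t : ℝ}
    (h : HasTraceDerivAt ρ D t) (hρ : ∀ s, IsBosonic (ρ s)) (hρs : ∀ s, TraceDominated (ρ s))
    (hD : IsBosonic D)
    (hDs : ∀ i j : Fin M → ι, Summable fun y : Fin K → ι => D (Fin.append i y) (Fin.append j y)) :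
    HasTraceDerivAt (fun s => BosonHierarchy.partialTrace M (ρ s))
      (BosonHierarchy.partialTrace M D) t := by
  refine tendsto_of_tendsto_of_tendsto_of_le_of_le tendsto_const_nhds h (fun _ => zero_le)
    fun s => ?_
  refine le_of_eq_of_le (congrArg traceNorm ?_) (traceNorm_tsum_append_le _ ?_)
  · funext i j
    have h1 := fun s => (hρs s).summable_joinTuple (L := K) rfl i j
    have h2 := hDs i j
    simp only [Matrix.sub_apply, Matrix.smul_apply, smul_eq_mul]
    rw [partialTrace_eq_tsum (L := K) rfl (hρ s) ((hρs s).summable_joinTuple (L := K) rfl),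
      partialTrace_eq_tsum (L := K) rfl (hρ t) ((hρs t).summable_joinTuple (L := K) rfl),
      partialTrace_eq_tsum (L := K) rfl hD hDs, ← (h1 s).tsum_sub (h1 t), ← tsum_mul_left]
    exact ((((h1 s).sub (h1 t)).mul_left _).tsum_sub h2).symm
  · intro i j
    have h1 := fun s => (hρs s).summable_joinTuple (L := K) rfl i j
    exact (((h1 s).sub (h1 t)).mul_left _).sub (hDs i j)

end traceNorm

end BosonHierarchy
-- The hierarchy equation
theorem mainTheorem1 {ι : Type*} [DecidableEq ι] (M K : ℕ) (ħ : ℝ) (hħ : 0 < ħ)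
    -- the one-particle and the two-particle term of the Hamiltonian
    (H₁ : NOp ι 1) (hH₁ : H₁.IsHermitian)
    (H₂ : NOp ι 2) (hH₂ : H₂.IsHermitian) (hH₂b : IsBosonic H₂)
    -- the state of `N = M + K` bosons
    (ρ : ℝ → NOp ι (M + K)) (hρ : ∀ s, IsDensityOperator (ρ s))
    (t : ℝ)
    (hvN : VonNeumannAt ħ
      (onSector H₁ (M + K) + onSector H₂ (M + K)) ρ t)
    (h₁ : ModeSumsConverge M K H₁ (ρ t))
    (h₂ : ModeSumsConverge M K H₂ (ρ t)) :
    -- the one-particle term: `Tr_{N-M} {[H₁, ρ]} = [H₁, ρ^{(M)}]`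
    (PartialTraceConverges M
        (opComm (onSector H₁ (M + K)) (ρ t)) ∧
      (∀ i j, CommConverges (onSector H₁ M)
        (partialTrace M (ρ t)) i j) ∧
      partialTrace M
          (opComm (onSector H₁ (M + K)) (ρ t)) =
        opComm (onSector H₁ M)
          (partialTrace M (ρ t))) ∧
    -- the two-particle term in terms of `ρ^{(M)}`, `ρ^{(M+1)}` and `ρ^{(M+2)}`
    (PartialTraceConverges M
        (opComm (onSector H₂ (M + K)) (ρ t)) ∧
      (∀ i j, CommConverges (onSector H₂ M)
        (partialTrace M (ρ t)) i j) ∧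
      (∀ i j,
        (∀ a, Summable (crossLeft H₂
            (partialTrace (M + 1) (ρ t)) a i j) ∧
          Summable (crossRight H₂
            (partialTrace (M + 1) (ρ t)) a i j)) ∧
        Summable (outerLeft H₂
          (partialTrace (M + 2) (ρ t)) i j) ∧
        Summable (outerRight H₂
          (partialTrace (M + 2) (ρ t)) i j) ∧
        partialTrace M
            (opComm (onSector H₂ (M + K)) (ρ t)) i j =
          opComm (onSector H₂ M)
              (partialTrace M (ρ t)) i j
            + (K : ℂ) * ∑ a : Fin M,
              ((∑' p, crossLeft H₂
                  (partialTrace (M + 1) (ρ t)) a i j p)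
                - ∑' p, crossRight H₂
                  (partialTrace (M + 1) (ρ t)) a i j p)
            + (K.choose 2 : ℂ) *
              ((∑' p, outerLeft H₂
                  (partialTrace (M + 2) (ρ t)) i j p)
                - ∑' p, outerRight H₂
                  (partialTrace (M + 2) (ρ t)) i j p) ∧
        -- the contributions of `ρ^{(M+2)}` cancel
        (∑' p, outerLeft H₂
            (partialTrace (M + 2) (ρ t)) i j p)
          - (∑' p, outerRight H₂
            (partialTrace (M + 2) (ρ t)) i j p) = 0)) ∧
    -- the hierarchy
    (∀ i j, CommConverges
      (onSector H₁ M + (1 - (K : ℂ)) • onSector H₂ M)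
      (partialTrace M (ρ t)) i j) ∧
    (∀ (i j : Fin M → ι) (l : ι), CommConverges
      (onSector H₂ (M + 1)) (partialTrace (M + 1) (ρ t))
      (Fin.snoc (α := fun _ => ι) i l) (Fin.snoc (α := fun _ => ι) j l)) ∧
    PartialTraceConverges M
      (opComm (onSector H₂ (M + 1))
        (partialTrace (M + 1) (ρ t))) ∧
    ∃ D : NOp ι M,
      HasTraceDerivAt (fun s => partialTrace M (ρ s)) D t ∧
      (Complex.I * (ħ : ℂ)) • D =
        opComm
            (onSector H₁ M + (1 - (K : ℂ)) • onSector H₂ M)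
            (partialTrace M (ρ t))
          + (K : ℂ) • partialTrace M
            (opComm (onSector H₂ (M + 1))
              (partialTrace (M + 1) (ρ t))) := by
  have hb := (hρ t).bosonic
  have hR := (hρ t).posSemidef.isHermitian
  have hd := (hρ t).traceDominated
  have hH₁b : IsBosonic H₁ := fun σ τ i j => by
    rw [Subsingleton.elim σ 1, Subsingleton.elim τ 1]; rfl
  have a₁ := h₁.actSummable hH₁b
  have a₂ := h₂.actSummable hH₂b
  -- the reduced operator of `M + 1` particles
  have hb' : IsBosonic (partialTrace (M + 1) (ρ t)) := isBosonic_partialTrace _ _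
  have hR' := isHermitian_partialTrace_succ hb hd hR
  have hd' := traceDominated_partialTrace_succ hb hd
  have a₂' : ActSummable (M := M) (K := 1) H₂ (partialTrace (M + 1) (ρ t)) :=
    a₂.reduce_add hb hd 1
  have c₁ := a₁.commConverges_partialTrace hb hd hH₁ hR
  have c₂ := a₂.commConverges_partialTrace hb hd hH₂ hR
  have e₁ := partialTrace_opComm_one a₁ hb hd hH₁ hR
  have e₂ := partialTrace_opComm_two a₂ hb hd hH₂ hH₂b hR
  refine ⟨⟨a₁.partialTraceConverges hb hH₁ hR, c₁, e₁⟩,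
    ⟨a₂.partialTraceConverges hb hH₂ hR, c₂, fun i j =>
      ⟨fun a => ⟨a₂.summable_crossLeft hb hd a i j, a₂.summable_crossRight hb hd hH₂ hR a i j⟩,
        a₂.summable_outerLeft hb hd i j, summable_outerRight (a₂.summable_outerLeft hb hd i j), ?_,
        tsum_outerLeft_sub_tsum_outerRight _ i j⟩⟩,
    fun i j => (c₁ i j).add_smul (c₂ i j) _, fun i j l => ?_,
    a₂'.partialTraceConverges hb' hH₂ hR', ?_⟩
  · rw [tsum_outerLeft_sub_tsum_outerRight, mul_zero, add_zero]
    exact e₂ i j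
  · have := a₂'.commConverges hb' hH₂ hR' i j fun _ => l
    rwa [Fin.append_right_eq_snoc, Fin.append_right_eq_snoc] at this
  -- the time derivative
  have hadd : ∀ (i j : Fin M → ι) (y : Fin K → ι),
      opComm (onSector H₁ (M + K) + onSector H₂ (M + K)) (ρ t) (Fin.append i y) (Fin.append j y) =
        opComm (onSector H₁ (M + K)) (ρ t) (Fin.append i y) (Fin.append j y) +
          opComm (onSector H₂ (M + K)) (ρ t) (Fin.append i y) (Fin.append j y) := by
    intro i j y
    simpa using opComm_add_smul (a₁.commConverges hb hH₁ hR i j y)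
      (a₂.commConverges hb hH₂ hR i j y) 1
  have s₁ := fun i j => (a₁.hasSum_opComm hb hH₁ hR i j).summable
  have s₂ := fun i j => (a₂.hasSum_opComm hb hH₂ hR i j).summable
  have b₁ := isBosonic_opComm (isBosonic_onSector H₁ (M + K)) hb
  have b₂ := isBosonic_opComm (isBosonic_onSector H₂ (M + K)) hb
  have bD : IsBosonic (-(Complex.I / (ħ : ℂ)) •
      opComm (onSector H₁ (M + K) + onSector H₂ (M + K)) (ρ t)) := by
    intro σ τ i j
    have hsum : IsBosonic (onSector H₁ (M + K) + onSector H₂ (M + K)) := fun σ τ i j => by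
      rw [Matrix.add_apply, Matrix.add_apply, isBosonic_onSector, isBosonic_onSector]
    exact congrArg (-(Complex.I / (ħ : ℂ)) • ·) (isBosonic_opComm hsum hb σ τ i j)
  have sD : ∀ i j : Fin M → ι, HasSum (fun y : Fin K → ι => (-(Complex.I / (ħ : ℂ)) •
      opComm (onSector H₁ (M + K) + onSector H₂ (M + K)) (ρ t)) (Fin.append i y) (Fin.append j y))
      (-(Complex.I / (ħ : ℂ)) * (partialTrace M (opComm (onSector H₁ (M + K)) (ρ t)) i j +
        partialTrace M (opComm (onSector H₂ (M + K)) (ρ t)) i j)) := by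
    intro i j
    rw [partialTrace_eq_tsum (L := K) rfl b₁ s₁, partialTrace_eq_tsum (L := K) rfl b₂ s₂]
    refine HasSum.congr_fun (((s₁ i j).hasSum.add (s₂ i j).hasSum).mul_left _) fun y => ?_
    rw [← hadd]
    rfl
  refine ⟨_, hvN.2.partialTrace (fun s => (hρ s).bosonic) (fun s => (hρ s).traceDominated) bD
    (fun i j => (sD i j).summable), ?_⟩
  funext i j
  have hħ' : (ħ : ℂ) ≠ 0 := by exact_mod_cast hħ.ne'
  have hD : (Complex.I * (ħ : ℂ)) * partialTrace M (-(Complex.I / (ħ : ℂ)) •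
      opComm (onSector H₁ (M + K) + onSector H₂ (M + K)) (ρ t)) i j =
      partialTrace M (opComm (onSector H₁ (M + K)) (ρ t)) i j +
        partialTrace M (opComm (onSector H₂ (M + K)) (ρ t)) i j := by
    rw [partialTrace_eq_tsum (L := K) rfl bD (fun i j => (sD i j).summable)]
    refine (congrArg _ (sD i j).tsum_eq).trans ?_
    rw [← mul_assoc]
    have : Complex.I * (ħ : ℂ) * -(Complex.I / (ħ : ℂ)) = 1 := by
      field_simp
      simp
    rw [this, one_mul]
  refine hD.trans ?_
  rw [Matrix.add_apply, Matrix.smul_apply, opComm_add_smul (c₁ i j) (c₂ i j), e₁, e₂, smul_eq_mul]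
  -- For `K = 0` the coefficient `K` removes every term in `ρ^{(M+1)}`.
  cases K with
  | zero => simp
  | succ L =>
    have hN : M + (L + 1) = M + 1 + L := by omega
    have t₁ : partialTrace M (partialTrace (M + 1) (ρ t)) = partialTrace M (ρ t) :=
      partialTrace_partialTrace hN hb hd
    -- Tracing out no particle (`A := 0`) leaves the operator unchanged.
    have t₂ : partialTrace (M + 1) (partialTrace (M + 1) (ρ t)) = partialTrace (M + 1) (ρ t) :=
      partialTrace_partialTrace (M := M + 1) (A := 0) hN hb hd
    -- With one traced particle the mixed sum appears with coefficient one; inserting this into the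
    -- goal cancels it and leaves `1 - K` in front of the `H₂` commutator.
    have e₃ := partialTrace_opComm_two a₂' hb' hd' hH₂ hH₂b hR' i j
    rw [t₁, t₂] at e₃
    rw [e₃]
    push_cast
    ring
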